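/- Let $\Bbbk$ be a field of characteristic zero, let $n\ge 0$, and let $b_{ij}\in\Bbbk\setminus\{0\}$, $c_{ij}^{l},d_{ij}\in\Bbbk$ ($1\le j<i\le n$, $1\le l\le n$) be the structure constants of a $G$-algebra $$A_n=\Bbbk\langle X_1,\dots,X_n\rangle\big/\big\langle X_iX_j-b_{ij}X_jX_i+\textstyle\sum_{l}c_{ij}^{l}X_l+d_{ij}\ \big|\ i>j\big\rangle .$$ Let $$B_n=\Bbbk\langle X_1,\dots,X_n,Z\rangle\big/\big\langle X_iX_j-b_{ij}X_jX_i+\textstyle\sum_{l}c_{ij}^{l}ZX_l+d_{ij}Z^2\ (i>j),\ \ X_iZ-ZX_i\big\rangle$$ be its homogenization, a noetherian $\mathbb Z$-graded algebra with all $X_i$ and the central element $Z$ in degree $1$. Let $(B_n)_Z$ be the (graded) localization of $B_n$ at $\{1,Z,Z^2,\dots\}$. Write $\operatorname{gr}_{B_n}$ and $\operatorname{gr}_{(B_n)_Z}$ for the abelian categories of finitely generated $\mathbb Z$-graded left modules with degree-zero homomorphisms, and $$Q=(B_n)_Z\otimes_{B_n}-\;:\ \operatorname{gr}_{B_n}\to\operatorname{gr}_{(B_n)_Z}$$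 for the (exact) localization functor. A module $M\in\operatorname{gr}_{B_n}$ is called torsion if it is the sum of its finite-dimensional submodules, and $Z$-torsion if for every $m\in M$ there is $l>0$ with $Z^l m=0$. Let $\operatorname{Qgr}_{B_n}$ be the quotient of the abelian category $\operatorname{gr}_{B_n}$ by the Serre subcategory of torsion modules, with exact quotient functor $\pi:\operatorname{gr}_{B_n}\to\operatorname{Qgr}_{B_n}$, and let $\psi:\operatorname{Qgr}_{B_n}\to\operatorname{gr}_{(B_n)_Z}$ be the exact functor with $\psi\pi\cong Q$, which exists because $Q$ inverts the maps with torsion kernel and cokernel. For an abelian category $\mathcal A$ let $C^b(\mathcal A)$, $K^b(\mathcal A)$, $D^b(\mathcal A)$ be the category of bounded complexes, its homotopy category, and the bounded derived category; an exact functor $F$ induces $C^b(F)$, $K^b(F)$, $D^b(F)$. A functor is dense if every object of the target is isomorphic to the image of an object. Then: 1. the functors $C^b(Q):C^b(\operatorname{gr}_{B_n})\to C^b(\operatorname{gr}_{(B_n)_Z})$ and $C^b(\psi):C^b(\operatorname{Qgr}_{B_n})\to C^b(\operatorname{gr}_{(B_n)_Z})$ are dense; 2. the functors $K^b(Q)$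 and $K^b(\psi)$ between the corresponding homotopy categories are dense; 3. the functors $D^b(Q):D^b(\operatorname{gr}_{B_n})\to D^b(\operatorname{gr}_{(B_n)_Z})$ and $D^b(\psi):D^b(\operatorname{Qgr}_{B_n})\to D^b(\operatorname{gr}_{(B_n)_Z})$ are dense; 4. let $\operatorname{Ker}D^b(\psi)$ be the class of all $X\in D^b(\operatorname{Qgr}_{B_n})$ such that $D^b(\psi)(X)$ is acyclic (all its homology objects vanish). An object $X\in D^b(\operatorname{Qgr}_{B_n})$ belongs to $\operatorname{Ker}D^b(\psi)$ if and only if $X\cong D^b(\pi)(M^\circ)$ for some $M^\circ\in D^b(\operatorname{gr}_{B_n})$ such that $H^i(M^\circ)$ is $Z$-torsion for every $i\in\mathbb Z$. -/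

import Mathlib

open CategoryTheory CategoryTheory.Limits
open scoped ZeroObject

universe u w₁ w₂ w₃

/-- A graded left module over a `ℤ`-graded `k`-algebra `B` (with homogeneous parts `𝓑 i`):
a left `B`-module `M = ⨁ i, M_i` with `B_i M_j ⊆ M_{i+j}`. -/
structure GrMod {k B : Type u} [Field k] [Ring B] [Algebra k B] (𝓑 : ℤ → Submodule k B) where
  carrier : Type u
  [addCommGroup : AddCommGroup carrier]
  [moduleBase : Module k carrier]
  [module : Module B carrier]
  [isScalarTower : IsScalarTower k B carrier]
  /-- the homogeneous components -/
  deg : ℤ → Submodule k carrier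
  isInternal : DirectSum.IsInternal deg
  smul_mem : ∀ {i j : ℤ} {b : B} {m : carrier}, b ∈ 𝓑 i → m ∈ deg j → b • m ∈ deg (i + j)

namespace GrMod

variable {k B : Type u} [Field k] [Ring B] [Algebra k B] {𝓑 : ℤ → Submodule k B}

instance : CoeSort (GrMod 𝓑) (Type u) := ⟨GrMod.carrier⟩

attribute [instance] addCommGroup moduleBase module isScalarTower

/-- Morphisms of graded modules: `B`-linear maps of degree zero. -/
@[ext]
structure Hom (M N : GrMod 𝓑) where
  toLin : M →ₗ[B] N
  map_deg : ∀ {i : ℤ} {m : M}, m ∈ M.deg i → toLin m ∈ N.deg i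

instance : Category (GrMod 𝓑) where
  Hom := Hom
  id M := ⟨LinearMap.id, fun h => h⟩
  comp f g := ⟨g.toLin ∘ₗ f.toLin, fun h => g.map_deg (f.map_deg h)⟩

/-- The `B`-linear map underlying a morphism. -/
def lin {M N : GrMod 𝓑} (f : M ⟶ N) : M →ₗ[B] N := Hom.toLin f

lemma lin_deg {M N : GrMod 𝓑} (f : M ⟶ N) {i : ℤ} {m : M} (h : m ∈ M.deg i) :
    lin f m ∈ N.deg i := Hom.map_deg f h

/-- Constructor for morphisms. -/
def ofLin {M N : GrMod 𝓑} (f : M →ₗ[B] N) (h : ∀ i m, m ∈ M.deg i → f m ∈ N.deg i) : M ⟶ N :=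
  Hom.mk f (fun {i m} => h i m)

@[simp] lemma lin_ofLin {M N : GrMod 𝓑} (f : M →ₗ[B] N) (h) : lin (ofLin f h) = f := rfl

@[simp] lemma lin_id (M : GrMod 𝓑) : lin (𝟙 M) = LinearMap.id := rfl

@[simp] lemma lin_comp {M N P : GrMod 𝓑} (f : M ⟶ N) (g : N ⟶ P) :
    lin (f ≫ g) = lin g ∘ₗ lin f := rfl

lemma hom_ext {M N : GrMod 𝓑} {f g : M ⟶ N} (h : ∀ m, lin f m = lin g m) : f = g :=
  Hom.ext (LinearMap.ext h)

instance (M N : GrMod 𝓑) : Zero (M ⟶ N) := ⟨ofLin 0 (fun i _ _ => (N.deg i).zero_mem)⟩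
instance (M N : GrMod 𝓑) : Add (M ⟶ N) :=
  ⟨fun f g => ofLin (lin f + lin g) (fun i _ h => (N.deg i).add_mem (lin_deg f h) (lin_deg g h))⟩
instance (M N : GrMod 𝓑) : Neg (M ⟶ N) :=
  ⟨fun f => ofLin (-lin f) (fun i _ h => (N.deg i).neg_mem (lin_deg f h))⟩
instance (M N : GrMod 𝓑) : Sub (M ⟶ N) :=
  ⟨fun f g => ofLin (lin f - lin g) (fun i _ h => (N.deg i).sub_mem (lin_deg f h) (lin_deg g h))⟩
instance (M N : GrMod 𝓑) : SMul ℕ (M ⟶ N) :=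
  ⟨fun a f => ofLin (a • lin f) (fun i _ h => (N.deg i).nsmul_mem (lin_deg f h) a)⟩
instance (M N : GrMod 𝓑) : SMul ℤ (M ⟶ N) :=
  ⟨fun a f => ofLin (a • lin f) (fun _ _ h => zsmul_mem (lin_deg f h) a)⟩

lemma lin_injective (M N : GrMod 𝓑) : Function.Injective (lin : (M ⟶ N) → (M →ₗ[B] N)) :=
  fun _ _ h => Hom.ext h

instance (M N : GrMod 𝓑) : AddCommGroup (M ⟶ N) :=
  (lin_injective M N).addCommGroup _ rfl (fun _ _ => rfl) (fun _ => rfl) (fun _ _ => rfl)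
    (fun _ _ => rfl) (fun _ _ => rfl)

@[simp] lemma lin_zero (M N : GrMod 𝓑) : lin (0 : M ⟶ N) = 0 := rfl
@[simp] lemma lin_add {M N : GrMod 𝓑} (f g : M ⟶ N) : lin (f + g) = lin f + lin g := rfl

instance : Preadditive (GrMod 𝓑) where
  add_comp _ _ _ f f' g := hom_ext fun m => by simp
  comp_add _ _ _ f g g' := hom_ext fun m => by simp

/-! ### Homogeneous components -/

/-- Criterion for a family of subspaces to be a direct sum decomposition. -/
lemma isInternal_of_proj {M : Type*} [AddCommGroup M] [Module k M] (d : ℤ → Submodule k M)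
    (p : ℤ → M →ₗ[k] M) (h1 : ∀ i, ∀ m ∈ d i, p i m = m)
    (h2 : ∀ i j, i ≠ j → ∀ m ∈ d j, p i m = 0) (h3 : ∀ m, m ∈ ⨆ i, d i) :
    DirectSum.IsInternal d := by
  rw [DirectSum.isInternal_submodule_iff_iSupIndep_and_iSup_eq_top]
  refine ⟨fun i => ?_, eq_top_iff.2 fun m _ => h3 m⟩
  rw [Submodule.disjoint_def]
  intro m hm hm'
  rw [← h1 i m hm]
  have : (⨆ j, ⨆ (_ : j ≠ i), d j) ≤ LinearMap.ker (p i) :=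
    iSup_le fun j => iSup_le fun hj m hm => h2 i j hj.symm m hm
  exact this hm'

/-- The decomposition isomorphism `⨁ i, M_i ≃ M`. -/
noncomputable def decomp (M : GrMod 𝓑) : (DirectSum ℤ fun i => M.deg i) ≃ₗ[k] M :=
  LinearEquiv.ofBijective (DirectSum.coeLinearMap M.deg)
    (show Function.Bijective (DirectSum.coeLinearMap M.deg) from M.isInternal)

lemma decomp_lof (M : GrMod 𝓑) (i : ℤ) (m : M.deg i) :
    M.decomp (DirectSum.lof k ℤ (fun i => M.deg i) i m) = m :=
  DirectSum.coeLinearMap_lof M.deg i m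

/-- The projection to the `i`-th homogeneous component. -/
noncomputable def proj (M : GrMod 𝓑) (i : ℤ) : M →ₗ[k] M :=
  (M.deg i).subtype ∘ₗ DirectSum.component k ℤ (fun i => M.deg i) i ∘ₗ M.decomp.symm.toLinearMap

lemma proj_mem (M : GrMod 𝓑) (i : ℤ) (m : M) : M.proj i m ∈ M.deg i := Subtype.prop _

lemma proj_of_mem (M : GrMod 𝓑) {i : ℤ} {m : M} (h : m ∈ M.deg i) (j : ℤ) :
    M.proj j m = if i = j then m else 0 := by
  have : M.decomp.symm m = DirectSum.lof k ℤ (fun i => M.deg i) i ⟨m, h⟩ := by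
    rw [LinearEquiv.symm_apply_eq, decomp_lof]
  simp only [proj, LinearMap.comp_apply, LinearEquiv.coe_coe, this]
  rw [DirectSum.component.of]
  split_ifs with hij
  · subst hij; rfl
  · rfl

lemma mem_iSup (M : GrMod 𝓑) (m : M) : m ∈ ⨆ i, M.deg i := by
  rw [M.isInternal.submodule_iSup_eq_top]; trivial

lemma exists_sum_proj (M : GrMod 𝓑) (m : M) : ∃ s : Finset ℤ, ∑ i ∈ s, M.proj i m = m := by
  classical
  obtain ⟨x, rfl⟩ := M.decomp.surjective m
  refine ⟨DFinsupp.support x, ?_⟩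
  have : ∀ i, M.proj i (M.decomp x) = (x i : M) := fun i => by
    simp only [proj, LinearMap.comp_apply, LinearEquiv.coe_coe, LinearEquiv.symm_apply_apply]
    rfl
  simp only [this]
  exact (DirectSum.coeLinearMap_eq_dfinsuppSum M.deg x).symm

lemma ext_proj (M : GrMod 𝓑) {m m' : M} (h : ∀ i, M.proj i m = M.proj i m') : m = m' := by
  have : ∀ m : M, (∀ i, M.proj i m = 0) → m = 0 := fun m hm => by
    obtain ⟨s, hs⟩ := M.exists_sum_proj m
    rw [← hs]; exact Finset.sum_eq_zero fun i _ => hm i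
  rw [← sub_eq_zero]
  exact this _ fun i => by rw [map_sub, h, sub_self]

lemma lin_smul {M N : GrMod 𝓑} (f : M ⟶ N) (c : k) (m : M) : lin f (c • m) = c • lin f m := by
  rw [← algebraMap_smul B c m, map_smul, algebraMap_smul]

lemma lin_proj {M N : GrMod 𝓑} (f : M ⟶ N) (i : ℤ) (m : M) :
    lin f (M.proj i m) = N.proj i (lin f m) := by
  have hm := M.mem_iSup m
  induction hm using Submodule.iSup_induction' with
  | mem j m hm =>
    rw [proj_of_mem M hm, proj_of_mem N (lin_deg f hm)]
    split_ifs <;> simp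
  | zero => simp
  | add x y _ _ hx hy => simp [hx, hy]

/-! ### Graded submodules, quotients and sums -/

/-- The graded submodule given by a homogeneous submodule. -/
def sub (M : GrMod 𝓑) (P : Submodule B M) (hP : ∀ i, ∀ m ∈ P, M.proj i m ∈ P) : GrMod 𝓑 where
  carrier := P
  deg i := (M.deg i).comap (P.subtype.restrictScalars k)
  isInternal := by
    refine isInternal_of_proj _
      (fun i => (M.proj i).restrict (p := P.restrictScalars k) (q := P.restrictScalars k) (hP i))
      ?_ ?_ ?_
    · intro i m hm
      apply Subtype.ext
      exact (proj_of_mem M (m := m) hm i).trans (if_pos rfl)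
    · intro i j hij m hm
      apply Subtype.ext
      exact (proj_of_mem M (m := m) hm i).trans (if_neg hij.symm)
    · intro m
      obtain ⟨s, hs⟩ := M.exists_sum_proj m
      have : m = ∑ i ∈ s, (⟨M.proj i m, hP i _ m.2⟩ : P) := by
        apply Subtype.ext
        rw [AddSubmonoidClass.coe_finsetSum]
        exact hs.symm
      rw [this]
      exact Submodule.sum_mem _ fun i _ => Submodule.mem_iSup_of_mem i (M.proj_mem i m)
  smul_mem hb hm := M.smul_mem hb hm

/-- The quotient by a homogeneous submodule. -/
def quot (M : GrMod 𝓑) (P : Submodule B M) (hP : ∀ i, ∀ m ∈ P, M.proj i m ∈ P) : GrMod 𝓑 where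
  carrier := M ⧸ P
  deg i := (M.deg i).map (P.mkQ.restrictScalars k)
  isInternal := by
    refine isInternal_of_proj _
      (fun i => (P.restrictScalars k).mapQ (P.restrictScalars k) (M.proj i) (hP i))
      ?_ ?_ ?_
    · rintro i _ ⟨m, hm, rfl⟩
      change Submodule.Quotient.mk (M.proj i m) = Submodule.Quotient.mk m
      rw [proj_of_mem M hm, if_pos rfl]
    · rintro i j hij _ ⟨m, hm, rfl⟩
      change Submodule.Quotient.mk (M.proj i m) = 0
      rw [proj_of_mem M hm, if_neg hij.symm]; rfl
    · intro m
      obtain ⟨m, rfl⟩ := P.mkQ_surjective m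
      obtain ⟨s, hs⟩ := M.exists_sum_proj m
      rw [← hs, map_sum]
      exact Submodule.sum_mem _ fun i _ => Submodule.mem_iSup_of_mem i ⟨_, M.proj_mem i m, rfl⟩
  smul_mem := by
    rintro i j b _ hb ⟨m, hm, rfl⟩
    exact ⟨b • m, M.smul_mem hb hm, rfl⟩

/-- The direct sum of two graded modules. -/
def prod (M N : GrMod 𝓑) : GrMod 𝓑 where
  carrier := M × N
  deg i := (M.deg i).prod (N.deg i)
  isInternal := by
    refine isInternal_of_proj _ (fun i => (M.proj i).prodMap (N.proj i)) ?_ ?_ ?_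
    · rintro i ⟨m, n⟩ ⟨hm, hn⟩
      simp only [LinearMap.prodMap_apply]
      rw [proj_of_mem M hm, proj_of_mem N hn, if_pos rfl, if_pos rfl]
    · rintro i j hij ⟨m, n⟩ ⟨hm, hn⟩
      simp only [LinearMap.prodMap_apply]
      rw [proj_of_mem M hm, proj_of_mem N hn, if_neg hij.symm, if_neg hij.symm]; rfl
    · rintro ⟨m, n⟩
      obtain ⟨s, hs⟩ := M.exists_sum_proj m
      obtain ⟨t, ht⟩ := N.exists_sum_proj n
      have : (m, n) = ∑ i ∈ s, (M.proj i m, (0 : N)) + ∑ i ∈ t, ((0 : M), N.proj i n) := by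
        apply Prod.ext
        · simp [Prod.fst_sum, hs]
        · simp [Prod.snd_sum, ht]
      rw [this]
      exact add_mem
        (Submodule.sum_mem _ fun i _ => Submodule.mem_iSup_of_mem i ⟨M.proj_mem i m, zero_mem _⟩)
        (Submodule.sum_mem _ fun i _ => Submodule.mem_iSup_of_mem i ⟨zero_mem _, N.proj_mem i n⟩)
  smul_mem hb hm := ⟨M.smul_mem hb hm.1, N.smul_mem hb hm.2⟩

/-- The zero graded module. -/
def zero : GrMod 𝓑 where
  carrier := PUnit
  deg _ := ⊤
  isInternal := isInternal_of_proj _ (fun _ => 0) (fun _ _ _ => rfl) (fun _ _ _ _ _ => rfl)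
    (fun m => by rw [Subsingleton.elim m 0]; exact zero_mem _)
  smul_mem _ _ := trivial

lemma isZero_of_subsingleton (M : GrMod 𝓑) [Subsingleton M] : IsZero M := by
  rw [IsZero.iff_id_eq_zero]
  exact hom_ext fun m => Subsingleton.elim _ _

instance : HasZeroObject (GrMod 𝓑) :=
  ⟨⟨zero, have : Subsingleton (zero (𝓑 := 𝓑)) := inferInstanceAs (Subsingleton PUnit)
    isZero_of_subsingleton _⟩⟩

instance : HasBinaryProducts (GrMod 𝓑) := by
  refine @hasBinaryProducts_of_hasLimit_pair _ _ (fun {M N} => ⟨⟨⟨BinaryFan.mk (P := prod M N)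
    (ofLin (LinearMap.fst B M N) fun i m hm => hm.1)
    (ofLin (LinearMap.snd B M N) fun i m hm => hm.2), ?_⟩⟩⟩)
  refine BinaryFan.IsLimit.mk _ (fun {T} f g => ofLin ((lin f).prod (lin g))
      fun i m hm => ⟨lin_deg f hm, lin_deg g hm⟩) ?_ ?_ ?_
  · intro T f g; rfl
  · intro T f g; rfl
  · intro T f g m h1 h2
    refine hom_ext fun x => Prod.ext ?_ ?_
    · exact LinearMap.congr_fun (congrArg lin h1) x
    · exact LinearMap.congr_fun (congrArg lin h2) x

instance : HasFiniteProducts (GrMod 𝓑) :=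
  hasFiniteProducts_of_has_binary_and_terminal

section KerCoker

variable {M N : GrMod 𝓑} (f : M ⟶ N)

lemma ker_homog (i : ℤ) (m : M) (hm : m ∈ LinearMap.ker (lin f)) :
    M.proj i m ∈ LinearMap.ker (lin f) := by
  rw [LinearMap.mem_ker] at *
  rw [lin_proj, hm, map_zero]

lemma range_homog (i : ℤ) (m : N) (hm : m ∈ LinearMap.range (lin f)) :
    N.proj i m ∈ LinearMap.range (lin f) := by
  obtain ⟨m, rfl⟩ := hm
  exact ⟨M.proj i m, lin_proj f i m⟩

/-- the kernel object -/
def kerObj : GrMod 𝓑 := M.sub (LinearMap.ker (lin f)) (ker_homog f)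

/-- the inclusion of the kernel -/
def kerι : kerObj f ⟶ M := ofLin (LinearMap.ker (lin f)).subtype fun _ _ h => h

lemma kerι_comp : kerι f ≫ f = 0 := hom_ext fun m => m.2

lemma lin_apply_eq_zero {M N P : GrMod 𝓑} {f : M ⟶ N} {g : N ⟶ P} (h : f ≫ g = 0) (m : M) :
    lin g (lin f m) = 0 := LinearMap.congr_fun (congrArg lin h) m

/-- `kerObj f` is a kernel of `f`. -/
def kerIsLimit : IsLimit (KernelFork.ofι (kerι f) (kerι_comp f)) :=
  KernelFork.IsLimit.ofι _ _
    (fun g hg => ofLin ((lin g).codRestrict (LinearMap.ker (lin f))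
      fun m => lin_apply_eq_zero hg m) fun _ _ hm => lin_deg g hm)
    (fun _ _ => rfl)
    (fun _ _ _ hm => hom_ext fun x => Subtype.ext (LinearMap.congr_fun (congrArg lin hm) x))

/-- the cokernel object -/
def cokerObj : GrMod 𝓑 := N.quot (LinearMap.range (lin f)) (range_homog f)

/-- the projection to the cokernel -/
def cokerπ : N ⟶ cokerObj f := ofLin (LinearMap.range (lin f)).mkQ fun _ _ h => ⟨_, h, rfl⟩

lemma comp_cokerπ : f ≫ cokerπ f = 0 :=
  hom_ext fun m => (Submodule.Quotient.mk_eq_zero _).2 ⟨m, rfl⟩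

/-- `cokerObj f` is a cokernel of `f`. -/
def cokerIsColimit : IsColimit (CokernelCofork.ofπ (cokerπ f) (comp_cokerπ f)) :=
  CokernelCofork.IsColimit.ofπ _ _
    (fun {W} g hg => ofLin ((LinearMap.range (lin f)).liftQ (lin g)
      (by rintro _ ⟨m, rfl⟩; exact lin_apply_eq_zero hg m))
      (by rintro i _ ⟨m, hm, rfl⟩; exact lin_deg g hm))
    (fun _ _ => rfl)
    (fun g hg m hm => hom_ext fun x => by
      obtain ⟨x, rfl⟩ := Submodule.mkQ_surjective _ x
      exact LinearMap.congr_fun (congrArg lin hm) x)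

instance : HasKernels (GrMod 𝓑) := ⟨fun f => ⟨⟨⟨_, kerIsLimit f⟩⟩⟩⟩
instance : HasCokernels (GrMod 𝓑) := ⟨fun f => ⟨⟨⟨_, cokerIsColimit f⟩⟩⟩⟩

lemma mono_iff : Mono f ↔ Function.Injective (lin f) := by
  constructor
  · intro h
    have : kerι f = 0 := by rw [← cancel_mono f, kerι_comp, zero_comp]
    rw [← LinearMap.ker_eq_bot, eq_bot_iff]
    intro m hm
    exact LinearMap.congr_fun (congrArg lin this) (⟨m, hm⟩ : LinearMap.ker (lin f))
  · intro h
    exact ⟨fun g g' e => hom_ext fun m => h (LinearMap.congr_fun (congrArg lin e) m)⟩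

lemma epi_iff : Epi f ↔ Function.Surjective (lin f) := by
  constructor
  · intro h
    have : cokerπ f = 0 := by rw [← cancel_epi f, comp_cokerπ, comp_zero]
    rw [← LinearMap.range_eq_top, eq_top_iff]
    intro m _
    exact (Submodule.Quotient.mk_eq_zero _).1 (LinearMap.congr_fun (congrArg lin this) m)
  · intro h
    exact ⟨fun g g' e => hom_ext fun m => by
      obtain ⟨m, rfl⟩ := h m
      exact LinearMap.congr_fun (congrArg lin e) m⟩

lemma mem_deg_of_injective (h : Function.Injective (lin f)) {i : ℤ} {m : M}
    (hm : lin f m ∈ N.deg i) : m ∈ M.deg i := by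
  have : M.proj i m = m := h (by rw [lin_proj, proj_of_mem N hm, if_pos rfl])
  rw [← this]; exact M.proj_mem i m

lemma exists_deg_of_surjective (h : Function.Surjective (lin f)) {i : ℤ} {n : N}
    (hn : n ∈ N.deg i) : ∃ m ∈ M.deg i, lin f m = n := by
  obtain ⟨m, rfl⟩ := h n
  exact ⟨M.proj i m, M.proj_mem i m, by rw [lin_proj, proj_of_mem N hn, if_pos rfl]⟩

/-- A monomorphism is the kernel of its cokernel. -/
@[reducible] noncomputable def normalMono (h : Function.Injective (lin f)) : NormalMono f where
  Z := cokerObj f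
  g := cokerπ f
  w := comp_cokerπ f
  isLimit := KernelFork.IsLimit.ofι _ _
    (fun {W} g hg => ofLin
      ((LinearEquiv.ofInjective (lin f) h).symm.toLinearMap ∘ₗ
        (lin g).codRestrict (LinearMap.range (lin f))
          (fun m => (Submodule.Quotient.mk_eq_zero _).1 (lin_apply_eq_zero hg m)))
      (fun i m hm => mem_deg_of_injective f h (by
        have : lin f ((LinearEquiv.ofInjective (lin f) h).symm ⟨lin g m,
          (Submodule.Quotient.mk_eq_zero _).1 (lin_apply_eq_zero hg m)⟩) = lin g m :=
          LinearEquiv.ofInjective_symm_apply (f := lin f) (h := h) ⟨lin g m, _⟩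
        exact this ▸ lin_deg g hm)))
    (fun {W} g hg => hom_ext fun m =>
      LinearEquiv.ofInjective_symm_apply (f := lin f) (h := h) ⟨lin g m,
          (Submodule.Quotient.mk_eq_zero _).1 (lin_apply_eq_zero hg m)⟩)
    (fun g hg m hm => hom_ext fun x => h (by
      rw [← LinearMap.comp_apply, ← lin_comp, hm]
      exact (LinearEquiv.ofInjective_symm_apply (f := lin f) (h := h) ⟨lin g x,
          (Submodule.Quotient.mk_eq_zero _).1 (lin_apply_eq_zero hg x)⟩).symm))

/-- An epimorphism is the cokernel of its kernel. -/
@[reducible] noncomputable def normalEpi (h : Function.Surjective (lin f)) : NormalEpi f where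
  W := kerObj f
  g := kerι f
  w := kerι_comp f
  isColimit := CokernelCofork.IsColimit.ofπ _ _
    (fun {W} g hg => ofLin
      ((LinearMap.ker (lin f)).liftQ (lin g) (fun m hm => lin_apply_eq_zero hg ⟨m, hm⟩) ∘ₗ
        ((lin f).quotKerEquivOfSurjective h).symm.toLinearMap)
      (fun i n hn => by
        obtain ⟨m, hm, rfl⟩ := exists_deg_of_surjective f h hn
        have : ((lin f).quotKerEquivOfSurjective h).symm (lin f m) = Submodule.Quotient.mk m := by
          rw [LinearEquiv.symm_apply_eq]; rfl
        rw [LinearMap.comp_apply, LinearEquiv.coe_coe, this]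
        exact lin_deg g hm))
    (fun {W} g hg => hom_ext fun m => by
      have : ((lin f).quotKerEquivOfSurjective h).symm (lin f m) = Submodule.Quotient.mk m := by
        rw [LinearEquiv.symm_apply_eq]; rfl
      rw [lin_comp, LinearMap.comp_apply, lin_ofLin, LinearMap.comp_apply, LinearEquiv.coe_coe,
        this]
      rfl)
    (fun g hg m hm => by
      have := (epi_iff f).2 h
      rw [← cancel_epi f, hm]
      refine hom_ext fun m => ?_
      have : ((lin f).quotKerEquivOfSurjective h).symm (lin f m) = Submodule.Quotient.mk m := by
        rw [LinearEquiv.symm_apply_eq]; rfl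
      rw [lin_comp, LinearMap.comp_apply, lin_ofLin, LinearMap.comp_apply, LinearEquiv.coe_coe,
        this]
      rfl)

end KerCoker

instance : IsNormalMonoCategory (GrMod 𝓑) := ⟨fun f hf => ⟨normalMono f ((mono_iff f).1 hf)⟩⟩
instance : IsNormalEpiCategory (GrMod 𝓑) := ⟨fun f hf => ⟨normalEpi f ((epi_iff f).1 hf)⟩⟩

/-- Graded modules form an abelian category. -/
noncomputable instance : Abelian (GrMod 𝓑) where


/-! ### Exactness -/

lemma exact_iff (S : ShortComplex (GrMod 𝓑)) :
    S.Exact ↔ ∀ m, lin S.g m = 0 → ∃ m', lin S.f m' = m := by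
  rw [S.exact_iff_kernel_ι_comp_cokernel_π_zero]
  have h1 : kernel.ι S.g = kernel.lift S.g _ (kernel.condition S.g) ≫ kernel.ι S.g := by simp
  let e := IsLimit.conePointUniqueUpToIso (kernelIsKernel S.g) (kerIsLimit S.g)
  let e' := IsColimit.coconePointUniqueUpToIso (cokernelIsCokernel S.f) (cokerIsColimit S.f)
  have he : e.hom ≫ kerι S.g = kernel.ι S.g :=
    IsLimit.conePointUniqueUpToIso_hom_comp _ (kerIsLimit S.g) WalkingParallelPair.zero
  have he' : cokernel.π S.f ≫ e'.hom = cokerπ S.f :=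
    IsColimit.comp_coconePointUniqueUpToIso_hom (cokernelIsCokernel S.f) _ WalkingParallelPair.one
  have : kernel.ι S.g ≫ cokernel.π S.f = 0 ↔ kerι S.g ≫ cokerπ S.f = 0 := by
    rw [← he, ← he', Category.assoc, Preadditive.IsIso.comp_left_eq_zero, ← Category.assoc]
    exact (Preadditive.IsIso.comp_right_eq_zero _ e'.hom).symm
  rw [this]
  constructor
  · intro h m hm
    exact (Submodule.Quotient.mk_eq_zero _).1
      (lin_apply_eq_zero h (⟨m, hm⟩ : LinearMap.ker (lin S.g)))
  · intro h
    refine hom_ext fun m => (Submodule.Quotient.mk_eq_zero _).2 ?_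
    obtain ⟨m', hm'⟩ := h (m : LinearMap.ker (lin S.g)).1 m.2
    exact ⟨m', hm'⟩

/-- The finitely generated graded modules. -/
def fg (𝓑 : ℤ → Submodule k B) : ObjectProperty (GrMod 𝓑) := fun M => Module.Finite B M

instance [IsNoetherianRing B] : (fg 𝓑).IsClosedUnderSubobjects where
  prop_of_mono f _ hY := by
    have : Module.Finite B _ := hY
    exact Module.Finite.of_injective (lin f) ((mono_iff f).1 inferInstance)

instance : (fg 𝓑).IsClosedUnderQuotients where
  prop_of_epi f _ hX := by
    have : Module.Finite B _ := hX
    exact Module.Finite.of_surjective (lin f) ((epi_iff f).1 inferInstance)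

lemma fg_of_isZero {M : GrMod 𝓑} (h : IsZero M) : fg 𝓑 M := by
  have : Subsingleton M := ⟨fun x y => by
    have := LinearMap.congr_fun (congrArg lin ((IsZero.iff_id_eq_zero M).1 h))
    rw [show x = 0 from this x, show y = 0 from this y]⟩
  exact (inferInstance : Module.Finite B M)

instance : (fg 𝓑).ContainsZero := ⟨⟨_, isZero_zero _, fg_of_isZero (isZero_zero _)⟩⟩

instance [IsNoetherianRing B] : (fg 𝓑).IsClosedUnderFiniteProducts := by
  have h0 : (fg 𝓑).IsClosedUnderLimitsOfShape (Discrete.{0} PEmpty) := ⟨by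
    rintro X ⟨p⟩
    refine fg_of_isZero ((IsZero.iff_id_eq_zero X).2 (p.isLimit.hom_ext ?_))
    rintro ⟨⟨⟩⟩⟩
  have h2 : (fg 𝓑).IsClosedUnderLimitsOfShape (Discrete WalkingPair) := ⟨by
    rintro X ⟨p⟩
    let M := p.diag.obj ⟨WalkingPair.left⟩
    let N := p.diag.obj ⟨WalkingPair.right⟩
    let f : X ⟶ M := p.π.app ⟨WalkingPair.left⟩
    let g : X ⟶ N := p.π.app ⟨WalkingPair.right⟩
    have hM : Module.Finite B M := p.prop_diag_obj ⟨WalkingPair.left⟩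
    have hN : Module.Finite B N := p.prop_diag_obj ⟨WalkingPair.right⟩
    let φ : X ⟶ prod M N := ofLin ((lin f).prod (lin g))
      fun i m hm => ⟨lin_deg f hm, lin_deg g hm⟩
    have : Mono φ := ⟨fun {T} a b hab => by
      refine p.isLimit.hom_ext ?_
      rintro ⟨⟨⟩⟩
      · exact hom_ext fun t => congrArg Prod.fst (LinearMap.congr_fun (congrArg lin hab) t)
      · exact hom_ext fun t => congrArg Prod.snd (LinearMap.congr_fun (congrArg lin hab) t)⟩
    exact (fg 𝓑).prop_of_mono φ (inferInstanceAs (Module.Finite B (M × N)))⟩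
  exact ObjectProperty.IsClosedUnderFiniteProducts.mk'

/-- The category `gr` of finitely generated graded modules and degree zero maps. -/
abbrev Gr (𝓑 : ℤ → Submodule k B) := (fg 𝓑).FullSubcategory

/-- The torsion objects: those `M` with `t(M) = M`, where `t(M)` is the sum of the submodules
of `M` which are finite dimensional over `k`. -/
def torsion (𝓑 : ℤ → Submodule k B) : ObjectProperty (Gr 𝓑) := fun M =>
  sSup {L : Submodule B M.obj | FiniteDimensional k L} = ⊤

lemma torsion_iff (M : Gr 𝓑) : torsion 𝓑 M ↔ FiniteDimensional k M.obj := by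
  constructor
  · intro h
    have hfg : Module.Finite B M.obj := M.property
    have key : ∀ m ∈ sSup {L : Submodule B M.obj | FiniteDimensional k L},
        ∃ L : Submodule B M.obj, FiniteDimensional k L ∧ m ∈ L := by
      intro m hm
      have hdir : DirectedOn (· ≤ ·) {L : Submodule B M.obj | FiniteDimensional k L} := by
        intro L hL L' hL'
        refine ⟨L ⊔ L', ?_, le_sup_left, le_sup_right⟩
        have h1 : FiniteDimensional k (L.restrictScalars k) := hL
        have h2 : FiniteDimensional k (L'.restrictScalars k) := hL'
        have : FiniteDimensional k ↥(L.restrictScalars k ⊔ L'.restrictScalars k) := inferInstance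
        rw [← Submodule.restrictScalars_sup] at this
        exact this
      rw [Submodule.mem_sSup_of_directed ⟨⊥, inferInstanceAs (FiniteDimensional k (⊥ : Submodule B M.obj))⟩ hdir] at hm
      obtain ⟨L, hL, hmL⟩ := hm
      exact ⟨L, hL, hmL⟩
    obtain ⟨s, hs⟩ := hfg
    have : ∀ m : M.obj, ∃ L : Submodule B M.obj, FiniteDimensional k L ∧ m ∈ L := fun m =>
      key m (by rw [h]; trivial)
    choose L hL hmL using this
    have htop : (s.sup fun m => (L m).restrictScalars k) = ⊤ := by
      have h2 : s.sup L = ⊤ := by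
        rw [eq_top_iff, ← hs, Submodule.span_le]
        intro m hm
        exact (Finset.le_sup (f := L) hm) (hmL m)
      rw [← Submodule.restrictScalars_top k B M.obj, ← h2]
      clear hs h2
      classical
      induction s using Finset.induction_on with
      | empty => simp
      | insert a s _ ih => rw [Finset.sup_insert, Finset.sup_insert, ih, Submodule.restrictScalars_sup]
    have (m : M.obj) : FiniteDimensional k ((L m).restrictScalars k) := hL m
    have : FiniteDimensional k ↥(s.sup fun m => (L m).restrictScalars k) :=
      Submodule.finite_finset_sup _ _
    rw [htop] at this
    exact Module.Finite.equiv (Submodule.topEquiv (R := k) (M := M.obj))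
  · intro h
    rw [torsion, eq_top_iff]
    exact le_sSup (show FiniteDimensional k (⊤ : Submodule B M.obj) from
      inferInstanceAs (FiniteDimensional k (⊤ : Submodule k M.obj)))

section Noeth

variable [IsNoetherianRing B]

instance : (fg 𝓑).ι.PreservesHomology where
  preservesKernels _ _ f := (fg 𝓑).preservesKernels_ι f
  preservesCokernels _ _ f := (fg 𝓑).preservesCokernels_ι f

lemma gr_exact_iff (S : ShortComplex (Gr 𝓑)) :
    S.Exact ↔ ∀ m, lin S.g.hom m = 0 → ∃ m', lin S.f.hom m' = m := by
  rw [← S.exact_map_iff_of_faithful (fg 𝓑).ι, exact_iff]; rfl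

lemma gr_mono_iff {M N : Gr 𝓑} (f : M ⟶ N) : Mono f ↔ Function.Injective (lin f.hom) := by
  rw [← mono_iff]
  exact ⟨fun _ => inferInstanceAs (Mono ((fg 𝓑).ι.map f)), fun h => (fg 𝓑).ι.mono_of_mono_map h⟩

lemma gr_epi_iff {M N : Gr 𝓑} (f : M ⟶ N) : Epi f ↔ Function.Surjective (lin f.hom) := by
  rw [← epi_iff]
  exact ⟨fun _ => inferInstanceAs (Epi ((fg 𝓑).ι.map f)), fun h => (fg 𝓑).ι.epi_of_epi_map h⟩

/-- The `k`-linear map underlying a morphism. -/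
def klin {M N : GrMod 𝓑} (f : M ⟶ N) : M →ₗ[k] N where
  toFun := lin f
  map_add' := map_add _
  map_smul' := lin_smul f

instance : (torsion 𝓑).IsSerreClass where
  exists_zero := ⟨0, isZero_zero _, by
    rw [torsion_iff]
    have : Subsingleton ((0 : Gr 𝓑).obj) := ⟨fun x y => by
      have h := (IsZero.iff_id_eq_zero _).1 (isZero_zero (Gr 𝓑))
      have := fun x => LinearMap.congr_fun (congrArg (fun f => lin f.hom) h) x
      rw [show x = 0 from this x, show y = 0 from this y]⟩
    infer_instance⟩
  prop_of_mono f _ hY := by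
    rw [torsion_iff] at *
    exact Module.Finite.of_injective (klin f.hom) ((gr_mono_iff f).1 inferInstance)
  prop_of_epi f _ hX := by
    rw [torsion_iff] at *
    exact Module.Finite.of_surjective (klin f.hom) ((gr_epi_iff f).1 inferInstance)
  prop_X₂_of_shortExact {S} hS h1 h3 := by
    rw [torsion_iff] at *
    have hm := hS.mono_f
    have he := hS.epi_g
    have hex := (gr_exact_iff S).1 hS.exact
    exact Module.Finite.of_exact (f := klin S.f.hom) (g := klin S.g.hom)
      (fun m => ⟨fun h => hex m h, fun ⟨m', h⟩ => by
        rw [← h]; exact lin_apply_eq_zero (congrArg (fun f => f.hom) S.zero) m'⟩)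
      ((gr_epi_iff S.g).1 he)

/-- The category `Qgr` of tails: the quotient of `gr` by the Serre subcategory of torsion
modules. -/
abbrev Qgr (𝓑 : ℤ → Submodule k B) := (torsion 𝓑).isoModSerre.Localization

/-- The quotient functor `π : gr → Qgr`. -/
noncomputable abbrev π (𝓑 : ℤ → Submodule k B) : Gr 𝓑 ⥤ Qgr 𝓑 := (torsion 𝓑).isoModSerre.Q

noncomputable instance : Abelian (Qgr 𝓑) :=
  ObjectProperty.SerreClassLocalization.abelian (π 𝓑) (torsion 𝓑)

instance : PreservesFiniteLimits (π 𝓑) :=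
  ObjectProperty.SerreClassLocalization.preservesFiniteLimits (π 𝓑) (torsion 𝓑)

instance : PreservesFiniteColimits (π 𝓑) :=
  ObjectProperty.SerreClassLocalization.preservesFiniteColimits (π 𝓑) (torsion 𝓑)

end Noeth

end GrMod

lemma exists_leading {k A ι Γ : Type*} [Field k] [AddCommGroup A] [Module k A] [LinearOrder Γ]
    (κ : ι → Γ) (hinj : Function.Injective κ) (u : ι → A) (S : Set ι) (f : A)
    (hf : f ∈ Submodule.span k (u '' S)) :
    f = 0 ∨ ∃ b ∈ S, ∃ c : k, c ≠ 0 ∧ f - c • u b ∈ Submodule.span k (u '' {x | κ x < κ b}) := by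
  classical
  obtain ⟨l, hl, rfl⟩ := (Finsupp.mem_span_image_iff_linearCombination k).1 hf
  by_cases h0 : l = 0
  · left; simp [h0]
  right
  obtain ⟨b, hb, hmax⟩ := l.support.exists_max_image κ (Finsupp.support_nonempty_iff.2 h0)
  refine ⟨b, hl hb, l b, Finsupp.mem_support_iff.1 hb, ?_⟩
  rw [Finsupp.linearCombination_apply, Finsupp.sum, ← Finset.add_sum_erase _ _ hb, add_sub_cancel_left]
  refine Submodule.sum_mem _ fun x hx => Submodule.smul_mem _ _ (Submodule.subset_span ⟨x, ?_, rfl⟩)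
  rw [Finset.mem_erase] at hx
  exact lt_of_le_of_ne (hmax x hx.2) fun h => hx.1 (hinj h)

theorem isNoetherianRing_of_monomials {k A ι Γ : Type*} [Field k] [Ring A] [Algebra k A]
    [AddCommMonoid ι] [PartialOrder ι] [CanonicallyOrderedAdd ι] [WellQuasiOrderedLE ι]
    [LinearOrder Γ] [WellFoundedLT Γ] (κ : ι → Γ) (hinj : Function.Injective κ) (u : ι → A)
    (hspan : Submodule.span k (Set.range u) = ⊤)
    (hκ : ∀ a b c, κ a < κ b → κ (c + a) < κ (c + b))
    (hmul : ∀ a b, ∃ c : k, c ≠ 0 ∧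
      u a * u b - c • u (a + b) ∈ Submodule.span k (u '' {x | κ x < κ (a + b)})) :
    IsNoetherianRing A := by
  classical
  set F : ι → Submodule k A := fun a => Submodule.span k (u '' {x | κ x < κ a}) with hF
  have Fmono : ∀ a b, κ a < κ b → F a ≤ F b := fun a b h =>
    Submodule.span_mono (Set.image_mono fun x hx => lt_trans hx h)
  have uF : ∀ a b, κ a < κ b → u a ∈ F b := fun a b h => Submodule.subset_span ⟨a, h, rfl⟩
  have mulF : ∀ c a, ∀ y ∈ F a, u c * y ∈ F (c + a) := by
    intro c a y hy
    induction hy using Submodule.span_induction with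
    | mem x hx =>
      obtain ⟨b, hb, rfl⟩ := hx
      obtain ⟨e, -, he⟩ := hmul c b
      have := add_mem (Fmono _ _ (hκ _ _ c hb) he) (Submodule.smul_mem _ e (uF _ _ (hκ _ _ c hb)))
      simpa using this
    | zero => simp
    | add x y _ _ hx hy => rw [mul_add]; exact add_mem hx hy
    | smul r x _ hx => rw [mul_smul_comm]; exact Submodule.smul_mem _ _ hx
  rw [isNoetherianRing_iff_ideal_fg]
  intro I
  let L : Set ι := {a | ∃ f ∈ I, f - u a ∈ F a}
  let M : Set ι := {a | Minimal (· ∈ L) a}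
  have hMfin : M.Finite := WellQuasiOrderedLE.finite_of_isAntichain (setOfPred_minimal_antichain _)
  have hMle : ∀ a ∈ L, ∃ m ∈ M, m ≤ a := fun a ha => by
    obtain ⟨m, hm, hm'⟩ := exists_minimal_le_of_wellFoundedLT (· ∈ L) a ha
    exact ⟨m, hm', hm⟩
  have hL : ∀ a : M, ∃ f ∈ I, f - u a ∈ F a := fun a => a.2.prop
  choose f hfI hfF using hL
  have : Finite M := hMfin
  refine ⟨(Set.finite_range f).toFinset, ?_⟩
  rw [Set.Finite.coe_toFinset]
  set J := Ideal.span (Set.range f)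
  have hJI : J ≤ I := Ideal.span_le.2 (by rintro _ ⟨m, rfl⟩; exact hfI m)
  refine le_antisymm hJI ?_
  have reduce : ∀ g ∈ I, ∀ b, ∀ c : k, c ≠ 0 → g - c • u b ∈ F b →
      ∃ j ∈ J, g - j ∈ F b := by
    intro g hg b c hc h
    have hbL : b ∈ L := by
      refine ⟨c⁻¹ • g, ?_, ?_⟩
      · rw [Algebra.smul_def]; exact I.mul_mem_left _ hg
      · have := Submodule.smul_mem _ c⁻¹ h
        rwa [smul_sub, smul_smul, inv_mul_cancel₀ hc, one_smul] at this
    obtain ⟨m, hm, hmb⟩ := hMle b hbL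
    obtain ⟨e, rfl⟩ := exists_add_of_le hmb
    obtain ⟨c', hc', h'⟩ := hmul e m
    rw [add_comm e m] at h'
    refine ⟨(c / c') • (u e * f ⟨m, hm⟩), ?_, ?_⟩
    · rw [Algebra.smul_def]
      exact J.mul_mem_left _ (J.mul_mem_left _ (Ideal.subset_span ⟨_, rfl⟩))
    · have h2 := mulF e m _ (hfF ⟨m, hm⟩)
      rw [add_comm e m, mul_sub] at h2
      have h3 := sub_mem h (Submodule.smul_mem _ (c / c') (add_mem h' h2))
      convert h3 using 1
      have : (c / c') * c' = c := by field_simp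
      simp only [smul_add, smul_sub, smul_smul, this]
      abel
  have main : ∀ γ : Γ, ∀ b, κ b = γ → ∀ g ∈ I, g ∈ F b → g ∈ J := by
    intro γ
    induction γ using WellFoundedLT.induction with
    | ind γ ih =>
      rintro b rfl g hg hgb
      rcases exists_leading κ hinj u _ g hgb with rfl | ⟨b', hb', c, hc, h⟩
      · exact J.zero_mem
      · obtain ⟨j, hj, hgj⟩ := reduce g hg b' c hc h
        have := ih (κ b') hb' b' rfl (g - j) (I.sub_mem hg (hJI hj)) hgj
        simpa using J.add_mem this hj
  intro g hg
  have hg' : g ∈ Submodule.span k (u '' Set.univ) := by rw [Set.image_univ, hspan]; trivial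
  rcases exists_leading κ hinj u _ g hg' with rfl | ⟨b', hb', c, hc, h⟩
  · exact J.zero_mem
  · obtain ⟨j, hj, hgj⟩ := reduce g hg b' c hc h
    have := main _ b' rfl (g - j) (I.sub_mem hg (hJI hj)) hgj
    simpa using J.add_mem this hj

/-- The structure constants of a `G`-algebra in `n` generators: for `j < i` the relation is
`X_i X_j - b_{ij} X_j X_i + ∑_l c_{ij}^l X_l + d_{ij} = 0` with `b_{ij} ≠ 0`. -/
structure GAlgData (k : Type u) [Field k] (n : ℕ) where
  b : Fin n → Fin n → k
  c : Fin n → Fin n → Fin n → k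
  d : Fin n → Fin n → k
  b_ne_zero : ∀ i j, j < i → b i j ≠ 0

namespace GAlgData

variable {k : Type u} [Field k] {n : ℕ} (D : GAlgData k n)

/-- The letters of `B_n`: `some i` is `X_i` and `none` is `Z`. -/
abbrev freeGen (k : Type u) [Field k] {n : ℕ} (a : Option (Fin n)) :
    FreeAlgebra k (Option (Fin n)) := FreeAlgebra.ι k a

/-- The defining relations of the homogenization `B_n`:
`X_i X_j = b_{ij} X_j X_i - ∑_l c_{ij}^l Z X_l - d_{ij} Z²` for `j < i`, and `X_i Z = Z X_i`. -/
inductive Rel : FreeAlgebra k (Option (Fin n)) → FreeAlgebra k (Option (Fin n)) → Prop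
  | comm (i j : Fin n) (hij : j < i) :
      Rel (freeGen k (some i) * freeGen k (some j))
        (D.b i j • (freeGen k (some j) * freeGen k (some i))
          - ∑ l, D.c i j l • (freeGen k none * freeGen k (some l))
          - D.d i j • (freeGen k none * freeGen k none))
  | central (i : Fin n) :
      Rel (freeGen k (some i) * freeGen k none) (freeGen k none * freeGen k (some i))

/-- The homogeneous `G`-algebra `B_n`. -/
def B : Type u := RingQuot D.Rel

noncomputable instance : Ring D.B := inferInstanceAs (Ring (RingQuot D.Rel))
noncomputable instance : Algebra k D.B := inferInstanceAs (Algebra k (RingQuot D.Rel))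

/-- The quotient map from the free algebra. -/
noncomputable def toB : FreeAlgebra k (Option (Fin n)) →ₐ[k] D.B := RingQuot.mkAlgHom k D.Rel

lemma toB_surjective : Function.Surjective D.toB := RingQuot.mkAlgHom_surjective k D.Rel

lemma toB_rel {x y} (h : D.Rel x y) : D.toB x = D.toB y := RingQuot.mkAlgHom_rel k h

/-- The class in `B_n` of a letter. -/
noncomputable def gen (a : Option (Fin n)) : D.B :=
  D.toB (FreeAlgebra.ι k a)

/-- The degree one central element `Z`. -/
noncomputable def Z : D.B := D.gen none

/-- The degree `i` part of `B_n`: the span of the words of length `i` in the letters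
(so it is zero for `i < 0`). -/
noncomputable def grading (i : ℤ) : Submodule k D.B :=
  Submodule.span k {x | ∃ l : List (Option (Fin n)), (l.length : ℤ) = i ∧ x = (l.map D.gen).prod}

lemma gen_comm (i j : Fin n) (hij : j < i) :
    D.gen (some i) * D.gen (some j) = D.b i j • (D.gen (some j) * D.gen (some i))
      - ∑ l, D.c i j l • (D.Z * D.gen (some l)) - D.d i j • (D.Z * D.Z) := by
  have := D.toB_rel (Rel.comm i j hij)
  simpa [gen, Z, freeGen] using this

lemma gen_mul_Z (a : Option (Fin n)) : D.gen a * D.Z = D.Z * D.gen a := by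
  cases a with
  | none => rfl
  | some i => 
    have := D.toB_rel (Rel.central i)
    simpa [gen, Z, freeGen] using this

lemma adjoin_gen : Algebra.adjoin k (Set.range D.gen) = ⊤ := by
  have h : Set.range D.gen = D.toB '' Set.range (FreeAlgebra.ι k) := by
    rw [← Set.range_comp]; rfl
  rw [h, ← AlgHom.map_adjoin, FreeAlgebra.adjoin_range_ι, Algebra.map_top, AlgHom.range_eq_top]
  exact D.toB_surjective

lemma span_words : Submodule.span k {x | ∃ l : List (Option (Fin n)), x = (l.map D.gen).prod} = ⊤ := by
  have h := D.adjoin_gen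
  apply_fun Subalgebra.toSubmodule at h
  rw [Algebra.adjoin_eq_span, Algebra.top_toSubmodule] at h
  rw [← top_le_iff, ← h]
  apply Submodule.span_mono
  intro x hx
  refine Submonoid.closure_induction (motive := fun x _ => ∃ l : List (Option (Fin n)), x = (l.map D.gen).prod) ?_ ?_ ?_ hx
  · rintro _ ⟨a, rfl⟩
    exact ⟨[a], by simp⟩
  · exact ⟨[], by simp⟩
  · rintro x y _ _ ⟨l, rfl⟩ ⟨l', rfl⟩
    exact ⟨l ++ l', by simp⟩

lemma Z_central (x : D.B) : Commute D.Z x := by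
  have hx : x ∈ Algebra.adjoin k (Set.range D.gen) := by rw [D.adjoin_gen]; trivial
  induction hx using Algebra.adjoin_induction with
  | mem x hx => obtain ⟨a, rfl⟩ := hx; exact (D.gen_mul_Z a).symm
  | algebraMap r => exact (Algebra.commutes r D.Z).symm
  | add x y _ _ hx hy => exact hx.add_right hy
  | mul x y _ _ hx hy => exact hx.mul_right hy

lemma Z_mem : D.Z ∈ D.grading 1 :=
  Submodule.subset_span ⟨[none], by simp, by simp [Z]⟩

lemma one_mem : (1 : D.B) ∈ D.grading 0 :=
  Submodule.subset_span ⟨[], by simp, by simp⟩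

lemma mul_mem {i j : ℤ} {x y : D.B} (hx : x ∈ D.grading i) (hy : y ∈ D.grading j) :
    x * y ∈ D.grading (i + j) := by
  have := Submodule.mul_mem_mul hx hy
  rw [grading, grading, Submodule.span_mul_span] at this
  refine Submodule.span_mono ?_ this
  rintro _ ⟨_, ⟨l, hl, rfl⟩, _, ⟨l', hl', rfl⟩, rfl⟩
  exact ⟨l ++ l', by simp [hl, hl'], by simp⟩

instance : SetLike.GradedMonoid D.grading where
  one_mem := D.one_mem
  mul_mem _ _ _ _ := D.mul_mem

/-! ### Noetherianity -/

/-- number of letters `X_i` in a word -/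
def xcount (l : List (Option (Fin n))) : ℕ := l.countP Option.isSome

/-- span of words with fewer than `d` letters `X_i` -/
noncomputable def filt (d : ℕ) : Submodule k D.B :=
  Submodule.span k {x | ∃ l : List (Option (Fin n)), xcount l < d ∧ x = (l.map D.gen).prod}

lemma filt_mono {d e : ℕ} (h : d ≤ e) : D.filt d ≤ D.filt e :=
  Submodule.span_mono fun _ ⟨l, hl, e⟩ => ⟨l, hl.trans_le h, e⟩

lemma word_mul_filt (l : List (Option (Fin n))) {d : ℕ} {y : D.B} (hy : y ∈ D.filt d) :
    (l.map D.gen).prod * y ∈ D.filt (xcount l + d) := by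
  induction hy using Submodule.span_induction with
  | mem x hx =>
    obtain ⟨l', hl', rfl⟩ := hx
    exact Submodule.subset_span ⟨l ++ l', by simp [xcount] at *; omega, by simp⟩
  | zero => simp
  | add x y _ _ hx hy => rw [mul_add]; exact add_mem hx hy
  | smul a x _ hx => rw [mul_smul_comm]; exact Submodule.smul_mem _ _ hx

lemma filt_mul_word (l : List (Option (Fin n))) {d : ℕ} {y : D.B} (hy : y ∈ D.filt d) :
    y * (l.map D.gen).prod ∈ D.filt (d + xcount l) := by
  induction hy using Submodule.span_induction with
  | mem x hx =>
    obtain ⟨l', hl', rfl⟩ := hx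
    exact Submodule.subset_span ⟨l' ++ l, by simp [xcount] at *; omega, by simp⟩
  | zero => simp
  | add x y _ _ hx hy => rw [add_mul]; exact add_mem hx hy
  | smul a x _ hx => rw [smul_mul_assoc]; exact Submodule.smul_mem _ _ hx

lemma swap_aux (i j : Fin n) (hij : j < i) :
    D.gen (some i) * D.gen (some j) - D.b i j • (D.gen (some j) * D.gen (some i)) ∈ D.filt 2 := by
  rw [D.gen_comm i j hij]
  have h1 : ∑ l, D.c i j l • (D.Z * D.gen (some l)) ∈ D.filt 2 :=
    Submodule.sum_mem _ fun l _ => Submodule.smul_mem _ _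
      (Submodule.subset_span ⟨[none, some l], by simp [xcount], by simp [Z]⟩)
  have h2 : D.d i j • (D.Z * D.Z) ∈ D.filt 2 := Submodule.smul_mem _ _
      (Submodule.subset_span ⟨[none, none], by simp [xcount], by simp [Z]⟩)
  have : D.b i j • (D.gen (some j) * D.gen (some i))
      - ∑ l, D.c i j l • (D.Z * D.gen (some l)) - D.d i j • (D.Z * D.Z) -
      D.b i j • (D.gen (some j) * D.gen (some i)) =
      -(∑ l, D.c i j l • (D.Z * D.gen (some l))) - D.d i j • (D.Z * D.Z) := by abel
  rw [this]
  exact sub_mem (neg_mem h1) h2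

lemma swap (a b : Option (Fin n)) :
    ∃ c : k, c ≠ 0 ∧ D.gen a * D.gen b - c • (D.gen b * D.gen a) ∈ D.filt (xcount [a, b]) := by
  cases a with
  | none => exact ⟨1, one_ne_zero, by have := D.gen_mul_Z b; rw [Z] at this; simp [this]⟩
  | some i =>
    cases b with
    | none => exact ⟨1, one_ne_zero, by have := D.gen_mul_Z (some i); rw [Z] at this; simp [this]⟩
    | some j =>
      rcases lt_trichotomy i j with h | rfl | h
      · refine ⟨(D.b j i)⁻¹, inv_ne_zero (D.b_ne_zero _ _ h), ?_⟩
        have := Submodule.smul_mem _ (-(D.b j i)⁻¹) (D.swap_aux j i h)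
        rw [smul_sub, smul_smul, neg_mul, inv_mul_cancel₀ (D.b_ne_zero _ _ h)] at this
        rw [neg_smul, neg_smul, one_smul, sub_neg_eq_add, add_comm, ← sub_eq_add_neg] at this
        exact this
      · exact ⟨1, one_ne_zero, by rw [one_smul, sub_self]; exact zero_mem _⟩
      · exact ⟨D.b i j, D.b_ne_zero _ _ h, D.swap_aux i j h⟩

lemma perm_words {l l' : List (Option (Fin n))} (h : l.Perm l') :
    ∃ c : k, c ≠ 0 ∧ (l.map D.gen).prod - c • (l'.map D.gen).prod ∈ D.filt (xcount l) := by
  induction h with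
  | nil => exact ⟨1, one_ne_zero, by simp⟩
  | cons a h ih =>
    obtain ⟨c, hc, h⟩ := ih
    refine ⟨c, hc, ?_⟩
    have := D.word_mul_filt [a] h
    rw [mul_sub, mul_smul_comm] at this
    rw [List.map_cons, List.prod_cons, List.map_cons, List.prod_cons]
    refine D.filt_mono ?_ (by simpa using this)
    simp [xcount, List.countP_cons, add_comm]
  | swap a b l =>
    obtain ⟨c, hc, h⟩ := D.swap b a
    refine ⟨c, hc, ?_⟩
    have := D.filt_mul_word l h
    rw [sub_mul, smul_mul_assoc, mul_assoc, mul_assoc] at this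
    simp only [List.map_cons, List.prod_cons]
    refine D.filt_mono ?_ this
    simp [xcount, List.countP_cons]; omega
  | trans h₁ h₂ ih₁ ih₂ =>
    obtain ⟨c, hc, h⟩ := ih₁
    obtain ⟨c', hc', h'⟩ := ih₂
    refine ⟨c * c', mul_ne_zero hc hc', ?_⟩
    have e : xcount _ = xcount _ := h₁.countP_eq Option.isSome
    rw [← e] at h'
    convert add_mem h (Submodule.smul_mem _ c h') using 1
    rw [smul_sub, smul_smul]; abel

/-- the ordered word with prescribed exponents -/
noncomputable def stdWord (a : Option (Fin n) →₀ ℕ) : List (Option (Fin n)) :=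
  (Finsupp.toMultiset a).toList

/-- the monomials -/
noncomputable def mono (a : Option (Fin n) →₀ ℕ) : D.B := ((stdWord a).map D.gen).prod

lemma xcount_perm {l l' : List (Option (Fin n))} (h : l.Perm l') : xcount l = xcount l' :=
  h.countP_eq _

lemma stdWord_perm (l : List (Option (Fin n))) :
    l.Perm (stdWord (Multiset.toFinsupp (l : Multiset (Option (Fin n))))) := by
  rw [← Multiset.coe_eq_coe]
  simp [stdWord]

lemma stdWord_add (a b : Option (Fin n) →₀ ℕ) :
    (stdWord a ++ stdWord b).Perm (stdWord (a + b)) := by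
  rw [← Multiset.coe_eq_coe, ← Multiset.coe_add]
  simp [stdWord]

lemma filt_le (d : ℕ) : D.filt d ≤ Submodule.span k (D.mono '' {x | xcount (stdWord x) < d}) := by
  induction d using Nat.strong_induction_on with
  | _ d ih =>
    refine Submodule.span_le.2 ?_
    rintro _ ⟨l, hl, rfl⟩
    obtain ⟨c, -, h⟩ := D.perm_words (stdWord_perm l)
    have h1 := (Submodule.span_mono (Set.image_mono fun x hx => lt_trans hx hl)) (ih _ hl h)
    have h2 : D.mono (Multiset.toFinsupp (l : Multiset (Option (Fin n)))) ∈
        Submodule.span k (D.mono '' {x | xcount (stdWord x) < d}) :=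
      Submodule.subset_span ⟨_, by rwa [Set.mem_ofPred_eq, ← xcount_perm (stdWord_perm l)], rfl⟩
    have := add_mem h1 (Submodule.smul_mem _ c h2)
    rwa [mono, sub_add_cancel] at this

instance : IsNoetherianRing D.B := by
  classical
  let e : (Option (Fin n) →₀ ℕ) ≃+ (Fin (n + 1) →₀ ℕ) :=
    Finsupp.domCongr (finSuccEquiv n).symm
  refine isNoetherianRing_of_monomials (k := k)
    (κ := fun a : Option (Fin n) →₀ ℕ => (toLex (xcount (stdWord a), toLex (e a)) :
      ℕ ×ₗ Lex (Fin (n + 1) →₀ ℕ))) ?_ D.mono ?_ ?_ ?_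
  · intro a b h
    simpa using congrArg (fun x => (ofLex x).2) h
  · rw [← top_le_iff, ← D.span_words]
    refine Submodule.span_le.2 ?_
    rintro _ ⟨l, rfl⟩
    have : (l.map D.gen).prod ∈ D.filt (xcount l + 1) :=
      Submodule.subset_span ⟨l, Nat.lt_succ_self _, rfl⟩
    exact Submodule.span_mono (Set.image_subset_range _ _) (D.filt_le _ this)
  · intro a b c h
    have hx : ∀ a b : Option (Fin n) →₀ ℕ,
        xcount (stdWord (a + b)) = xcount (stdWord a) + xcount (stdWord b) := fun a b => by
      rw [← xcount_perm (stdWord_add a b)]; simp [xcount]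
    rw [Prod.Lex.toLex_lt_toLex] at h ⊢
    simp only [hx, map_add]
    rcases h with h | ⟨h, h'⟩
    · left; simpa using h
    · right; refine ⟨by simpa using h, ?_⟩
      rw [toLex_add, toLex_add]
      exact add_lt_add_right h' _
  · intro a b
    obtain ⟨c, hc, h⟩ := D.perm_words (stdWord_add a b)
    refine ⟨c, hc, ?_⟩
    have := D.filt_le _ h
    rw [List.map_append, List.prod_append] at this
    refine Submodule.span_mono (Set.image_mono fun x hx => ?_) this
    rw [Set.mem_ofPred_eq, xcount_perm (stdWord_add a b)] at hx
    exact Prod.Lex.toLex_lt_toLex.2 (Or.inl hx)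

end GAlgData

namespace GAlgData

variable {k : Type u} [Field k] {n : ℕ} (D : GAlgData k n)

/-- The algebra map `B_n → B_n[T, T⁻¹]` sending each letter `a` to `a T`. -/
noncomputable def coaction : D.B →ₐ[k] AddMonoidAlgebra D.B ℤ :=
  RingQuot.liftAlgHom k ⟨FreeAlgebra.lift k fun a => AddMonoidAlgebra.single 1 (D.gen a), by
    intro x y h
    have hsum : ∀ (s : Finset (Fin n)) (f : Fin n → D.B), ∑ l ∈ s, AddMonoidAlgebra.single
        (1 + 1 : ℤ) (f l) = AddMonoidAlgebra.single (1 + 1 : ℤ) (∑ l ∈ s, f l) := by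
      intro s f
      classical
      induction s using Finset.induction_on with
      | empty => simp only [Finset.sum_empty, AddMonoidAlgebra.single_zero]
      | insert a s ha ih =>
        rw [Finset.sum_insert ha, Finset.sum_insert ha, ih, AddMonoidAlgebra.single_add]
    cases h with
    | comm i j hij =>
      have := congrArg (AddMonoidAlgebra.single (1 + 1 : ℤ)) (D.gen_comm i j hij)
      simp only [Z] at this
      simp only [freeGen, map_mul, map_sub, map_smul, map_sum, FreeAlgebra.lift_ι_apply,
        AddMonoidAlgebra.single_mul_single, AddMonoidAlgebra.smul_single, this,
        AddMonoidAlgebra.single_sub, hsum]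
    | central i =>
      have := congrArg (AddMonoidAlgebra.single (1 + 1 : ℤ)) (D.gen_mul_Z (some i))
      simp only [Z] at this
      simp only [freeGen, map_mul, FreeAlgebra.lift_ι_apply,
        AddMonoidAlgebra.single_mul_single, this]⟩

lemma coaction_gen (a : Option (Fin n)) :
    D.coaction (D.gen a) = AddMonoidAlgebra.single 1 (D.gen a) := by
  rw [coaction, gen, toB]
  erw [RingQuot.liftAlgHom_mkAlgHom_apply]
  rw [FreeAlgebra.lift_ι_apply]; rfl

lemma coaction_of_mem {i : ℤ} {x : D.B} (hx : x ∈ D.grading i) :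
    D.coaction x = AddMonoidAlgebra.single i x := by
  induction hx using Submodule.span_induction with
  | mem x hx =>
    obtain ⟨l, rfl, rfl⟩ := hx
    induction l with
    | nil => rw [List.map_nil, List.prod_nil, map_one, AddMonoidAlgebra.one_def]; rfl
    | cons a l ih =>
      rw [List.map_cons, List.prod_cons, map_mul, coaction_gen, ih,
        AddMonoidAlgebra.single_mul_single, List.length_cons, Nat.cast_succ, add_comm]
  | zero => rw [map_zero, AddMonoidAlgebra.single_zero]
  | add x y _ _ hx hy => rw [map_add, hx, hy, AddMonoidAlgebra.single_add]
  | smul c x _ hx => rw [map_smul, hx, AddMonoidAlgebra.smul_single]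

/-- `B_n` is the direct sum of its homogeneous parts. -/
lemma grading_isInternal : DirectSum.IsInternal D.grading := by
  refine GrMod.isInternal_of_proj (k := k) D.grading
    (fun i => (Finsupp.lapply i : (ℤ →₀ D.B) →ₗ[k] D.B) ∘ₗ (AddMonoidAlgebra.coeffLinearEquiv k).toLinearMap ∘ₗ D.coaction.toLinearMap) ?_ ?_ ?_
  · intro i m hm
    change (D.coaction m).coeff i = m
    rw [D.coaction_of_mem hm, AddMonoidAlgebra.coeff_single, Finsupp.single_eq_same]
  · intro i j hij m hm
    change (D.coaction m).coeff i = 0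
    rw [D.coaction_of_mem hm, AddMonoidAlgebra.coeff_single, Finsupp.single_eq_of_ne hij]
  · intro m
    have hm : m ∈ Submodule.span k {x | ∃ l : List (Option (Fin n)), x = (l.map D.gen).prod} := by
      rw [D.span_words]; trivial
    refine (Submodule.span_le.2 ?_) hm
    rintro _ ⟨l, rfl⟩
    exact Submodule.mem_iSup_of_mem (l.length : ℤ) (Submodule.subset_span ⟨l, rfl, rfl⟩)

end GAlgData

namespace GAlgData

open OreLocalization

variable {k : Type u} [Field k] {n : ℕ} (D : GAlgData k n)

/-- The multiplicative set `{1, Z, Z², …}`. -/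
noncomputable def S : Submonoid D.B := Submonoid.powers D.Z

lemma S_central (s : D.S) (x : D.B) : (s : D.B) * x = x * s := by
  obtain ⟨_, m, rfl⟩ := s
  exact ((D.Z_central x).pow_left m).eq

/-- Central multiplicative sets satisfy the Ore condition. -/
noncomputable instance : OreSet D.S where
  ore_right_cancel r₁ r₂ s h := ⟨s, by rw [S_central, S_central, h]⟩
  oreNum r _ := r
  oreDenom _ s := s
  ore_eq r s := D.S_central s r

/-- The powers of `Z` as elements of the multiplicative set. -/
noncomputable def zpw (m : ℕ) : D.S := ⟨D.Z ^ m, m, rfl⟩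

@[simp] lemma coe_zpw (m : ℕ) : (D.zpw m : D.B) = D.Z ^ m := rfl

lemma zpw_mul (l m : ℕ) : D.zpw l * D.zpw m = D.zpw (l + m) :=
  Subtype.ext (pow_add D.Z l m).symm

lemma exists_zpw (s : D.S) : ∃ m, s = D.zpw m := by
  obtain ⟨_, m, rfl⟩ := s; exact ⟨m, rfl⟩

/-- The localization `(B_n)_Z`. -/
abbrev BZ : Type u := OreLocalization D.S D.B

section Mod

variable {M : Type*} [AddCommGroup M] [Module D.B M]

lemma oreDiv_zpw (m : M) (l j : ℕ) : m /ₒ D.zpw j = (D.Z ^ l • m) /ₒ D.zpw (l + j) := by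
  rw [← zpw_mul, OreLocalization.expand' m (D.zpw j) (D.zpw l)]; rfl

lemma exists_rep (x : OreLocalization D.S M) : ∃ (m : M) (j : ℕ), x = m /ₒ D.zpw j := by
  induction x using OreLocalization.ind with
  | _ m s => obtain ⟨j, rfl⟩ := D.exists_zpw s; exact ⟨m, j, rfl⟩

lemma oreDiv_eq_zero (m : M) (s : D.S) : m /ₒ s = 0 ↔ ∃ l : ℕ, D.Z ^ l • m = 0 := by
  rw [OreLocalization.zero_def, OreLocalization.oreDiv_eq_iff]
  constructor
  · rintro ⟨u, v, h1, h2⟩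
    obtain ⟨l, hl⟩ := D.exists_zpw u
    refine ⟨l, ?_⟩
    rw [← coe_zpw, ← hl]
    simp only [OneMemClass.coe_one, mul_one] at h2
    rw [h2, ← S_central, mul_smul, ← h1, smul_zero, smul_zero]
  · rintro ⟨l, hl⟩
    refine ⟨D.zpw l * s, D.zpw l, ?_, ?_⟩
    · rw [smul_zero, coe_zpw, hl]
    · simp

lemma add_zpw (m m' : M) (i j : ℕ) :
    m /ₒ D.zpw i + m' /ₒ D.zpw j = (D.Z ^ j • m + D.Z ^ i • m') /ₒ D.zpw (i + j) := by
  rw [D.oreDiv_zpw m j i, D.oreDiv_zpw m' i j, add_comm j i, add_oreDiv]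

lemma smul_zpw (b : D.B) (m : M) (i j : ℕ) :
    (b /ₒ D.zpw i : D.BZ) • (m /ₒ D.zpw j) = (b • m) /ₒ D.zpw (i + j) := by
  rw [oreDiv_smul_char b m (D.zpw i) (D.zpw j) b (D.zpw j) (D.S_central _ _), zpw_mul, add_comm]

variable [Module k M] [IsScalarTower k D.B M]

lemma base_smul_oreDiv (c : k) (m : M) (s : D.S) :
    c • (m /ₒ s : OreLocalization D.S M) = (c • m) /ₒ s := by
  rw [smul_oreDiv]
  change ((c • (1 : D.B)) • m) /ₒ s = _
  rw [smul_assoc, one_smul]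

/-- The degree `i` part of a localization: the fractions `m / Z^j` with `m` of degree `i + j`. -/
def locDeg (d : ℤ → Submodule k M) (hd : ∀ i, ∀ m ∈ d i, D.Z • m ∈ d (i + 1)) (i : ℤ) :
    Submodule k (OreLocalization D.S M) where
  carrier := {x | ∃ (j : ℕ) (m : M), m ∈ d (i + j) ∧ x = m /ₒ D.zpw j}
  zero_mem' := ⟨0, 0, zero_mem _, by rw [zero_oreDiv]⟩
  add_mem' := by
    have hd' : ∀ (l : ℕ) i, ∀ m ∈ d i, D.Z ^ l • m ∈ d (i + l) := by
      intro l
      induction l with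
      | zero => intro i m hm; simpa using hm
      | succ l ih =>
        intro i m hm
        rw [pow_succ', mul_smul, Nat.cast_succ, ← add_assoc]
        exact hd _ _ (ih i m hm)
    rintro _ _ ⟨j, m, hm, rfl⟩ ⟨j', m', hm', rfl⟩
    refine ⟨j + j', _, ?_, D.add_zpw m m' j j'⟩
    refine add_mem ?_ ?_
    · have := hd' j' _ _ hm
      rwa [add_assoc, ← Nat.cast_add] at this
    · have := hd' j _ _ hm'
      rwa [add_assoc, ← Nat.cast_add, add_comm j'] at this
  smul_mem' := by
    rintro c _ ⟨j, m, hm, rfl⟩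
    exact ⟨j, c • m, Submodule.smul_mem _ _ hm, D.base_smul_oreDiv c m _⟩

end Mod

lemma Z_smul_mem {M : GrMod D.grading} {i : ℤ} {m : M} (h : m ∈ M.deg i) :
    D.Z • m ∈ M.deg (i + 1) := by
  rw [add_comm]; exact M.smul_mem D.Z_mem h

lemma Z_pow_smul_mem {M : GrMod D.grading} (l : ℕ) {i : ℤ} {m : M} (h : m ∈ M.deg i) :
    D.Z ^ l • m ∈ M.deg (i + l) := by
  induction l with
  | zero => simpa using h
  | succ l ih =>
    rw [pow_succ', mul_smul, Nat.cast_succ, ← add_assoc]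
    exact D.Z_smul_mem ih

/-- The grading of `(B_n)_Z`: in degree `i` the fractions `b / Z^j` with `b` of degree `i + j`. -/
noncomputable def gradingZ (i : ℤ) : Submodule k D.BZ :=
  D.locDeg D.grading (fun i m hm => by
    rw [add_comm, smul_eq_mul]; exact D.mul_mem D.Z_mem hm) i

/-- The localization `M_Z = (B_n)_Z ⊗ M` of a graded module. -/
noncomputable def locObj (M : GrMod D.grading) : GrMod D.gradingZ where
  carrier := OreLocalization D.S M
  deg := D.locDeg M.deg (fun _ _ hm => D.Z_smul_mem hm)
  isInternal := by
    classical
    refine ⟨?_, ?_⟩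
    · rw [injective_iff_map_eq_zero]
      intro x hx
      have hx' : ∑ i ∈ DFinsupp.support x, ((x i : OreLocalization D.S M)) = 0 := by
        rw [← hx]; exact (DirectSum.coeLinearMap_eq_dfinsuppSum (R := k) _ x).symm
      have hrep : ∀ i, ∃ (j : ℕ) (m : M), m ∈ M.deg (i + j) ∧
        (x i : OreLocalization D.S M) = m /ₒ D.zpw j := fun i => (x i).2
      choose j m hm hxm using hrep
      let K := (DFinsupp.support x).sup j
      let m' : ℤ → M := fun i => D.Z ^ (K - j i) • m i
      have hm' : ∀ i ∈ DFinsupp.support x, m' i ∈ M.deg (i + K) ∧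
          (x i : OreLocalization D.S M) = m' i /ₒ D.zpw K := by
        intro i hi
        have hle : j i ≤ K := Finset.le_sup (f := j) hi
        constructor
        · have := D.Z_pow_smul_mem (K - j i) (hm i)
          rwa [add_assoc, ← Nat.cast_add, Nat.add_sub_cancel' hle] at this
        · rw [hxm i, D.oreDiv_zpw (m i) (K - j i) (j i), Nat.sub_add_cancel hle]
      have hsum : (∑ i ∈ DFinsupp.support x, m' i) /ₒ D.zpw K = 0 := by
        rw [← hx', Finset.sum_congr rfl fun i hi => (hm' i hi).2]
        generalize DFinsupp.support x = s
        induction s using Finset.induction_on with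
        | empty => simp
        | insert a s ha ih =>
          rw [Finset.sum_insert ha, Finset.sum_insert ha, ← ih, add_oreDiv]
      obtain ⟨l, hl⟩ := (D.oreDiv_eq_zero _ _).1 hsum
      rw [Finset.smul_sum] at hl
      have hz : ∀ i ∈ DFinsupp.support x, D.Z ^ l • m' i = 0 := by
        intro i hi
        have := congrArg (M.proj (i + K + l)) hl
        rw [map_sum, map_zero, Finset.sum_eq_single_of_mem i hi] at this
        · rwa [M.proj_of_mem (D.Z_pow_smul_mem l (hm' i hi).1), if_pos rfl] at this
        · intro b hb hbi
          rw [M.proj_of_mem (D.Z_pow_smul_mem l (hm' b hb).1), if_neg]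
          intro h; apply hbi; omega
      refine DFinsupp.ext fun i => ?_
      by_cases hi : i ∈ DFinsupp.support x
      · apply Subtype.ext
        rw [(hm' i hi).2]
        exact (D.oreDiv_eq_zero _ _).2 ⟨l, hz i hi⟩
      · exact DFinsupp.notMem_support_iff.1 hi
    · intro x
      change x ∈ LinearMap.range (DirectSum.coeLinearMap _)
      rw [DirectSum.range_coeLinearMap]
      obtain ⟨m, j, rfl⟩ := D.exists_rep x
      obtain ⟨s, hs⟩ := M.exists_sum_proj m
      rw [← hs]
      have : ∀ s : Finset ℤ, (∑ i ∈ s, M.proj i m) /ₒ D.zpw j =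
          ∑ i ∈ s, (M.proj i m /ₒ D.zpw j : OreLocalization D.S M) := by
        intro s
        induction s using Finset.induction_on with
        | empty => simp
        | insert a s ha ih => rw [Finset.sum_insert ha, Finset.sum_insert ha, ← ih, add_oreDiv]
      rw [this]
      refine Submodule.sum_mem _ fun i _ => Submodule.mem_iSup_of_mem (i - j) ?_
      exact ⟨j, _, by rw [sub_add_cancel]; exact M.proj_mem i m, rfl⟩
  smul_mem := by
    rintro i i' _ _ ⟨j, b, hb, rfl⟩ ⟨j', m, hm, rfl⟩
    refine ⟨j + j', b • m, ?_, D.smul_zpw b m j j'⟩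
    have := M.smul_mem hb hm
    rwa [show i + (j : ℤ) + (i' + j') = i + i' + ((j + j' : ℕ) : ℤ) by push_cast; ring] at this

/-- The localization of a linear map. -/
noncomputable def locLin {M N : Type*} [AddCommGroup M] [Module D.B M] [AddCommGroup N]
    [Module D.B N] (f : M →ₗ[D.B] N) : OreLocalization D.S M →ₗ[D.BZ] OreLocalization D.S N where
  toFun := liftExpand (fun m s => f m /ₒ s) (fun m t s hs => by
    rw [map_smul]; exact OreLocalization.expand (f m) s t hs)
  map_add' x y := by
    obtain ⟨m, i, rfl⟩ := D.exists_rep x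
    obtain ⟨m', j, rfl⟩ := D.exists_rep y
    rw [add_zpw, liftExpand_of, liftExpand_of, liftExpand_of, add_zpw, map_add, map_smul, map_smul]
  map_smul' r x := by
    obtain ⟨m, i, rfl⟩ := D.exists_rep x
    obtain ⟨b, j, rfl⟩ := D.exists_rep r
    rw [smul_zpw, liftExpand_of, liftExpand_of, RingHom.id_apply, smul_zpw, map_smul]

@[simp] lemma locLin_oreDiv {M N : Type*} [AddCommGroup M] [Module D.B M] [AddCommGroup N]
    [Module D.B N] (f : M →ₗ[D.B] N) (m : M) (s : D.S) : D.locLin f (m /ₒ s) = f m /ₒ s := rfl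

/-- The localization functor on graded modules. -/
noncomputable def locFunctor : GrMod D.grading ⥤ GrMod D.gradingZ where
  obj := D.locObj
  map {M N} f := GrMod.ofLin (M := D.locObj M) (N := D.locObj N) (D.locLin (GrMod.lin f)) (by
    rintro i _ ⟨j, m, hm, rfl⟩
    exact ⟨j, GrMod.lin f m, GrMod.lin_deg f hm, rfl⟩)
  map_id M := GrMod.hom_ext fun x => by
    obtain ⟨m, i, rfl⟩ := D.exists_rep (M := M) x
    rfl
  map_comp {M N P} f g := GrMod.hom_ext fun x => by
    obtain ⟨m, i, rfl⟩ := D.exists_rep (M := M) x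
    rfl

lemma fg_loc {M : Type*} [AddCommGroup M] [Module D.B M] (h : Module.Finite D.B M) :
    Module.Finite D.BZ (OreLocalization D.S M) := by
  classical
  obtain ⟨s, hs⟩ := h
  refine ⟨s.image (fun m => m /ₒ D.zpw 0), ?_⟩
  rw [eq_top_iff]
  intro x _
  obtain ⟨m, i, rfl⟩ := D.exists_rep x
  have hm : m ∈ Submodule.span D.B (s : Set M) := by rw [hs]; trivial
  have key : ∀ m ∈ Submodule.span D.B (s : Set M), m /ₒ D.zpw 0 ∈
      Submodule.span D.BZ ((s.image (fun m => m /ₒ D.zpw 0) : Finset _) :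
        Set (OreLocalization D.S M)) := by
    intro m hm
    induction hm using Submodule.span_induction with
    | mem x hx => exact Submodule.subset_span (by simpa using ⟨x, hx, rfl⟩)
    | zero => rw [zero_oreDiv]; exact zero_mem _
    | add x y _ _ hx hy => rw [← add_oreDiv]; exact add_mem hx hy
    | smul b x _ hx =>
      have := Submodule.smul_mem _ (b /ₒ D.zpw 0 : D.BZ) hx
      rwa [smul_zpw] at this
  have := Submodule.smul_mem _ ((1 : D.B) /ₒ D.zpw i : D.BZ) (key m hm)
  rwa [smul_zpw, one_smul, add_zero] at this

instance : IsNoetherianRing D.BZ := by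
  rw [isNoetherianRing_iff_ideal_fg]
  intro I
  classical
  let J : Ideal D.B :=
    { carrier := {b | (b /ₒ D.zpw 0 : D.BZ) ∈ I}
      zero_mem' := by
        change (0 : D.B) /ₒ D.zpw 0 ∈ I
        rw [zero_oreDiv]; exact zero_mem _
      add_mem' := fun {a b} ha hb => by
        change (a + b) /ₒ D.zpw 0 ∈ I
        rw [← add_oreDiv]; exact add_mem ha hb
      smul_mem' := fun c b hb => by
        change (c • b) /ₒ D.zpw 0 ∈ I
        have := I.mul_mem_left (c /ₒ D.zpw 0 : D.BZ) hb
        rwa [← smul_eq_mul, smul_zpw] at this }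
  obtain ⟨s, hs⟩ := (isNoetherianRing_iff_ideal_fg D.B).1 inferInstance J
  have hsub : ∀ b ∈ J, (b /ₒ D.zpw 0 : D.BZ) ∈
      Ideal.span ((s.image (fun b => (b /ₒ D.zpw 0 : D.BZ)) : Finset D.BZ) : Set D.BZ) := by
    intro b hb
    rw [← hs] at hb
    induction hb using Submodule.span_induction with
    | mem x hx => exact Submodule.subset_span (by simpa using ⟨x, hx, rfl⟩)
    | zero => rw [zero_oreDiv]; exact zero_mem _
    | add x y _ _ hx hy => rw [← add_oreDiv]; exact add_mem hx hy
    | smul b x _ hx =>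
      have := Submodule.smul_mem _ (b /ₒ D.zpw 0 : D.BZ) hx
      rwa [smul_zpw] at this
  refine ⟨s.image (fun b => (b /ₒ D.zpw 0 : D.BZ)), le_antisymm ?_ ?_⟩
  · refine Ideal.span_le.2 ?_
    intro x hx
    obtain ⟨b, hb, rfl⟩ := Finset.mem_image.1 (Finset.mem_coe.1 hx)
    have : b ∈ J := by rw [← hs]; exact Submodule.subset_span hb
    exact this
  · intro x hx
    obtain ⟨b, i, rfl⟩ := D.exists_rep x
    have hb : b ∈ J := by
      have h := I.mul_mem_left (D.Z ^ i /ₒ D.zpw 0 : D.BZ) hx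
      rw [← smul_eq_mul, smul_zpw, zero_add] at h
      change (b /ₒ D.zpw 0 : D.BZ) ∈ I
      have e : (b /ₒ D.zpw 0 : D.BZ) = (D.Z ^ i • b) /ₒ D.zpw i := by
        have := D.oreDiv_zpw b i 0
        rwa [add_zero] at this
      rw [e]; exact h
    have := Ideal.mul_mem_left _ ((1 : D.B) /ₒ D.zpw i : D.BZ) (hsub b hb)
    rwa [← smul_eq_mul, smul_zpw, one_smul, add_zero] at this

/-- The category `gr_{B_n}`. -/
abbrev gr := GrMod.Gr D.grading

/-- The category `gr_{(B_n)_Z}`. -/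
abbrev grZ := GrMod.Gr D.gradingZ

/-- The category `Qgr_{B_n}`. -/
abbrev qgr := GrMod.Qgr D.grading

/-- The quotient functor `π : gr_{B_n} → Qgr_{B_n}`. -/
noncomputable abbrev π : D.gr ⥤ D.qgr := GrMod.π D.grading

/-- The localization functor `Q = (B_n)_Z ⊗ - : gr_{B_n} → gr_{(B_n)_Z}`. -/
noncomputable def Q : D.gr ⥤ D.grZ :=
  ObjectProperty.lift _ ((GrMod.fg D.grading).ι ⋙ D.locFunctor) (fun M => D.fg_loc M.property)

instance : D.Q.Additive where
  map_add {M N f g} := by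
    apply InducedCategory.Hom.ext
    refine GrMod.hom_ext fun x => ?_
    obtain ⟨m, i, rfl⟩ := D.exists_rep (M := M.obj) x
    exact (add_oreDiv (r := GrMod.lin f.hom m) (r' := GrMod.lin g.hom m) (s := D.zpw i)).symm

lemma Q_shortExact (T : ShortComplex D.gr) (hT : T.ShortExact) : (T.map D.Q).ShortExact := by
  have hm := (GrMod.gr_mono_iff _).1 hT.mono_f
  have he := (GrMod.gr_epi_iff _).1 hT.epi_g
  have hex := (GrMod.gr_exact_iff _).1 hT.exact
  have h1 : (T.map D.Q).Exact := by
    refine (GrMod.gr_exact_iff _).2 ?_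
    intro x hx
    obtain ⟨m, i, rfl⟩ := D.exists_rep (M := T.X₂.obj) x
    obtain ⟨l, hl⟩ := (D.oreDiv_eq_zero (GrMod.lin T.g.hom m) _).1 hx
    rw [← map_smul] at hl
    obtain ⟨m', hm'⟩ := hex _ hl
    refine ⟨(m' /ₒ D.zpw (l + i) : OreLocalization D.S T.X₁.obj), ?_⟩
    rw [D.oreDiv_zpw m l i, ← hm']; rfl
  have h2 : Mono (T.map D.Q).f := by
    refine (GrMod.gr_mono_iff _).2 ?_
    refine (injective_iff_map_eq_zero (GrMod.lin (T.map D.Q).f.hom)).2 ?_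
    intro x hx
    obtain ⟨m, i, rfl⟩ := D.exists_rep (M := T.X₁.obj) x
    obtain ⟨l, hl⟩ := (D.oreDiv_eq_zero (GrMod.lin T.f.hom m) _).1 hx
    rw [← map_smul] at hl
    exact (D.oreDiv_eq_zero m _).2 ⟨l, hm (hl.trans (map_zero _).symm)⟩
  have h3 : Epi (T.map D.Q).g := by
    refine (GrMod.gr_epi_iff _).2 ?_
    intro x
    obtain ⟨m, i, rfl⟩ := D.exists_rep (M := T.X₃.obj) x
    obtain ⟨m', rfl⟩ := he m
    exact ⟨(m' /ₒ D.zpw i : OreLocalization D.S T.X₂.obj), rfl⟩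
  exact { exact := h1, mono_f := h2, epi_g := h3 }

lemma Q_exact : PreservesFiniteLimits D.Q ∧ PreservesFiniteColimits D.Q :=
  (D.Q.exact_tfae.out 0 3 :).1 D.Q_shortExact

instance : PreservesFiniteLimits D.Q := D.Q_exact.1

instance : PreservesFiniteColimits D.Q :=
  D.Q_exact.2

/-- A graded module is `Z`-torsion if each element is killed by a power of `Z`. -/
def IsZTorsion (M : D.gr) : Prop := ∀ m : M.obj, ∃ l : ℕ, 0 < l ∧ D.Z ^ l • m = 0

lemma isZTorsion_of_torsion (M : D.gr) (h : GrMod.torsion D.grading M) : D.IsZTorsion M := by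
  rw [GrMod.torsion_iff] at h
  have hind := (DirectSum.isInternal_submodule_iff_iSupIndep_and_iSup_eq_top _).1 M.obj.isInternal
  have hfin : {i | M.obj.deg i ≠ ⊥}.Finite := WellFoundedGT.finite_ne_bot_of_iSupIndep hind.1
  obtain ⟨K, hK⟩ := hfin.bddAbove
  have hzero : ∀ i, K < i → ∀ m ∈ M.obj.deg i, m = 0 := by
    intro i hi m hm
    by_contra hne
    exact absurd (hK (show M.obj.deg i ≠ ⊥ from fun h => hne (by rw [h] at hm; exact hm))) (by omega)
  intro m
  obtain ⟨s, hs⟩ := M.obj.exists_sum_proj m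
  let l : ℕ := s.sup (fun i => (K - i).toNat) + 1
  refine ⟨l, Nat.succ_pos _, ?_⟩
  rw [← hs, Finset.smul_sum]
  refine Finset.sum_eq_zero fun i hi => hzero (i + l) ?_ _ (D.Z_pow_smul_mem l (M.obj.proj_mem i m))
  have : (K - i).toNat ≤ s.sup (fun i => (K - i).toNat) := Finset.le_sup (f := fun i => (K - i).toNat) hi
  omega

lemma Q_inverts : (GrMod.torsion D.grading).isoModSerre.IsInvertedBy D.Q := by
  rw [ObjectProperty.isoModSerre_isInvertedBy_iff]
  intro M hM
  change IsZero (D.Q.obj M)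
  rw [IsZero.iff_id_eq_zero]
  apply InducedCategory.Hom.ext
  refine GrMod.hom_ext fun x => ?_
  obtain ⟨m, i, rfl⟩ := D.exists_rep (M := M.obj) x
  obtain ⟨l, -, hl⟩ := D.isZTorsion_of_torsion M hM m
  exact (D.oreDiv_eq_zero m _).2 ⟨l, hl⟩

/-- The functor `ψ : Qgr_{B_n} → gr_{(B_n)_Z}` with `ψ π = Q`. -/
noncomputable def ψ : D.qgr ⥤ D.grZ := Localization.lift D.Q D.Q_inverts D.π

/-- The isomorphism `ψ π ≅ Q` characterizing `ψ`. -/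
noncomputable def πCompψ : D.π ⋙ D.ψ ≅ D.Q := Localization.fac D.Q D.Q_inverts D.π

instance : PreservesFiniteLimits D.ψ := by
  rw [← ObjectProperty.SerreClassLocalization.preservesFiniteLimits_comp_iff D.π
    (GrMod.torsion D.grading)]
  exact preservesFiniteLimits_of_natIso D.πCompψ.symm

instance : PreservesFiniteColimits D.ψ := by
  rw [← ObjectProperty.SerreClassLocalization.preservesFiniteColimits_comp_iff D.π
    (GrMod.torsion D.grading)]
  exact preservesFiniteColimits_of_natIso D.πCompψ.symm

instance : D.ψ.Additive := D.ψ.additive_of_preserves_binary_products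

end GAlgData

/-! ### Categories of bounded complexes and induced functors -/

section BoundedComplexes

universe v₁ v₂ u₁ u₂

/-- The bounded cochain complexes. -/
def boundedComplex (A : Type u₁) [Category.{v₁} A] [Preadditive A] :
    ObjectProperty (CochainComplex A ℤ) :=
  fun K => (∃ a : ℤ, K.IsStrictlyGE a) ∧ ∃ b : ℤ, K.IsStrictlyLE b

/-- The category `C^b(A)` of bounded complexes. -/
abbrev Cb (A : Type u₁) [Category.{v₁} A] [Preadditive A] := (boundedComplex A).FullSubcategory

/-- The category `K^b(A)` of bounded complexes with homotopy classes of maps. -/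
abbrev Kb (A : Type u₁) [Category.{v₁} A] [Preadditive A] :=
  ((boundedComplex A).strictMap
    (HomotopyCategory.quotient A (ComplexShape.up ℤ))).FullSubcategory

variable {A : Type u₁} [Category.{v₁} A] [Abelian A] {A' : Type u₂} [Category.{v₂} A'] [Abelian A']
  (F : A ⥤ A') [F.Additive]

lemma map_isStrictlyGE (K : CochainComplex A ℤ) (a : ℤ) [K.IsStrictlyGE a] :
    CochainComplex.IsStrictlyGE ((F.mapHomologicalComplex (ComplexShape.up ℤ)).obj K) a := by
  rw [CochainComplex.isStrictlyGE_iff]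
  exact fun i hi => F.map_isZero (K.isZero_of_isStrictlyGE a i hi)

lemma map_isStrictlyLE (K : CochainComplex A ℤ) (b : ℤ) [K.IsStrictlyLE b] :
    CochainComplex.IsStrictlyLE ((F.mapHomologicalComplex (ComplexShape.up ℤ)).obj K) b := by
  rw [CochainComplex.isStrictlyLE_iff]
  exact fun i hi => F.map_isZero (K.isZero_of_isStrictlyLE b i hi)

lemma boundedComplex_map {K : CochainComplex A ℤ} (hK : boundedComplex A K) :
    boundedComplex A' ((F.mapHomologicalComplex (ComplexShape.up ℤ)).obj K) := by
  obtain ⟨⟨a, ha⟩, b, hb⟩ := hK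
  exact ⟨⟨a, map_isStrictlyGE F K a⟩, b, map_isStrictlyLE F K b⟩

/-- The functor `C^b(F)`, which applies `F` termwise. -/
noncomputable def mapCb : Cb A ⥤ Cb A' :=
  (boundedComplex A').lift
    ((boundedComplex A).ι ⋙ F.mapHomologicalComplex (ComplexShape.up ℤ))
    (fun K => boundedComplex_map F K.property)

/-- The functor `K^b(F)`, which applies `F` termwise. -/
noncomputable def mapKb : Kb A ⥤ Kb A' :=
  ObjectProperty.lift _
    (ObjectProperty.ι _ ⋙ F.mapHomotopyCategory (ComplexShape.up ℤ))
    (fun X => by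
      obtain ⟨_, ⟨K, hK⟩⟩ := X
      exact ⟨_, boundedComplex_map F hK⟩)

variable [HasDerivedCategory.{w₁} A] [HasDerivedCategory.{w₂} A'] [PreservesFiniteLimits F]
  [PreservesFiniteColimits F]

lemma bounded_mapDerivedCategory (X : DerivedCategory A)
    (hX : (DerivedCategory.TStructure.t (C := A)).bounded X) :
    (DerivedCategory.TStructure.t (C := A')).bounded (F.mapDerivedCategory.obj X) := by
  obtain ⟨⟨a, ha⟩, b, hb⟩ := hX
  obtain ⟨K, hKa, hKb, ⟨e⟩⟩ := X.exists_iso_Q_obj_of_isGE_of_isLE a b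
  let e' := F.mapDerivedCategory.mapIso e ≪≫ F.mapDerivedCategoryFactors.app K
  exact ⟨⟨a, ⟨⟨_, e', map_isStrictlyGE F K a⟩⟩⟩, b, ⟨⟨_, e', map_isStrictlyLE F K b⟩⟩⟩

/-- The functor `D^b(F)` induced by an exact functor `F`, which applies `F` termwise to
complexes. -/
noncomputable def mapDb : DerivedCategory.Bounded A ⥤ DerivedCategory.Bounded A' :=
  (DerivedCategory.TStructure.t (C := A')).bounded.lift
    (DerivedCategory.Bounded.ι ⋙ F.mapDerivedCategory)
    (fun X => bounded_mapDerivedCategory F X.obj X.property)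

/-- The kernel of `D^b(F)`: the objects sent to acyclic objects. -/
def kerDb : ObjectProperty (DerivedCategory.Bounded A) := fun X =>
  ∀ i : ℤ, IsZero ((DerivedCategory.homologyFunctor A' i).obj ((mapDb F).obj X).obj)

end BoundedComplexes

/-!
Every statement comes from lifting complexes at the level of modules; density passes from `C^b` to
`K^b` and `D^b` because every object there is represented by a bounded complex
(`essSurj_mapKb`, `essSurj_mapDb`).

*Density of `C^b(Q)`.* Let `K` be a bounded complex of finitely generated graded
`(B_n)_Z`-modules, and choose finite sets `G_i` of homogeneous generators of the `K^i`. The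
`B_n`-submodule of `K^i` spanned by `G_i ∪ d(G_{i-1})` is a finitely generated graded lattice, and
since `d² = 0` these lattices form a subcomplex (`resD_mem_latSubmodule`). A lattice localizes to
the module it generates (`isIso_adj`), so the subcomplex is a preimage of `K`. As `ψ π ≅ Q`, the
functor `C^b(ψ)` is dense as well.

*Density of `C^b(π)`.* Modulo torsion, a finitely generated graded module `M` agrees with its
truncations `M_{≥ p}` (`isoModSerre_truncι`). As torsion modules are finite dimensional, a morphism
`π M ⟶ π N` is represented by a morphism `M_{≥ p} ⟶ N` for all large `p`
(`exists_map_eq_truncι_comp`), and a morphism killed by `π` vanishes on all sufficiently high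
truncations (`exists_truncMap_eq_zero`). So the differentials of a bounded complex in `Qgr`, and
the relations `d² = 0`, lift to `gr` after a common truncation (`essSurj_mapCb_π`).

*The kernel of `D^b(ψ)`.* By the preceding point any object of `D^b(Qgr)` is some `D^b(π)(M)`.
Exact functors commute with homology, so `D^b(ψ) D^b(π)(M)` has homology `Q(H^i(M))`, and `Q`
annihilates precisely the `Z`-torsion modules (`isZero_Q_obj_iff`).
-/

/-! ### Induced functors on categories of complexes -/

section InducedFunctors

universe v₁ v₂ u₁ u₂

variable {A : Type u₁} [Category.{v₁} A] [Abelian A] {A' : Type u₂} [Category.{v₂} A'] [Abelian A']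
  (F : A ⥤ A') [F.Additive]

lemma essSurj_mapKb (h : (mapCb F).EssSurj) : (mapKb F).EssSurj where
  mem_essImage X := by
    obtain ⟨_, ⟨K, hK⟩⟩ := X
    obtain ⟨M, ⟨e⟩⟩ := h.mem_essImage ⟨K, hK⟩
    exact ⟨⟨_, ⟨M.obj, M.property⟩⟩, ⟨ObjectProperty.isoMk _
      ((HomotopyCategory.quotient A' (ComplexShape.up ℤ)).mapIso
        ((boundedComplex A').ι.mapIso e))⟩⟩

lemma mapCb_congr_essSurj {F G : A ⥤ A'} [F.Additive] [G.Additive] (e : F ≅ G)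
    (h : (mapCb F).EssSurj) : (mapCb G).EssSurj where
  mem_essImage X := by
    obtain ⟨M, ⟨e'⟩⟩ := h.mem_essImage X
    exact ⟨M, ⟨ObjectProperty.isoMk _
      (((NatIso.mapHomologicalComplex e (ComplexShape.up ℤ)).app M.obj).symm ≪≫
        (boundedComplex A').ι.mapIso e')⟩⟩

variable [HasDerivedCategory.{w₁} A] [HasDerivedCategory.{w₂} A'] [PreservesFiniteLimits F]
  [PreservesFiniteColimits F]

lemma bounded_Q_obj {K : CochainComplex A ℤ} (hK : boundedComplex A K) :
    (DerivedCategory.TStructure.t (C := A)).bounded (DerivedCategory.Q.obj K) := by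
  obtain ⟨⟨a, ha⟩, b, hb⟩ := hK
  exact ⟨⟨a, ⟨⟨K, Iso.refl _, ha⟩⟩⟩, b, ⟨⟨K, Iso.refl _, hb⟩⟩⟩

lemma essSurj_mapDb (h : (mapCb F).EssSurj) : (mapDb F).EssSurj where
  mem_essImage X := by
    obtain ⟨X, ⟨a, ha⟩, b, hb⟩ := X
    obtain ⟨K, hKa, hKb, ⟨e⟩⟩ := X.exists_iso_Q_obj_of_isGE_of_isLE a b
    obtain ⟨M, ⟨e'⟩⟩ := h.mem_essImage ⟨K, ⟨a, hKa⟩, b, hKb⟩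
    exact ⟨⟨_, bounded_Q_obj M.property⟩, ⟨ObjectProperty.isoMk _
      (F.mapDerivedCategoryFactors.app M.obj ≪≫
        DerivedCategory.Q.mapIso ((boundedComplex A').ι.mapIso e') ≪≫ e.symm)⟩⟩

/-- An exact functor commutes with the homology of complexes. -/
lemma nonempty_homologyFunctor_mapDerivedCategory_iso (X : DerivedCategory A) (i : ℤ) :
    Nonempty ((DerivedCategory.homologyFunctor A' i).obj (F.mapDerivedCategory.obj X) ≅
      F.obj ((DerivedCategory.homologyFunctor A i).obj X)) := by
  have := Localization.essSurj (DerivedCategory.Q (C := A))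
    (HomologicalComplex.quasiIso A (ComplexShape.up ℤ))
  let K := DerivedCategory.Q.objPreimage X
  let e : DerivedCategory.Q.obj K ≅ X := DerivedCategory.Q.objObjPreimageIso X
  exact ⟨(DerivedCategory.homologyFunctor A' i).mapIso (F.mapDerivedCategory.mapIso e.symm ≪≫
      F.mapDerivedCategoryFactors.app K) ≪≫
    (DerivedCategory.homologyFunctorFactors A' i).app _ ≪≫
    (K.sc i).mapHomologyIso F ≪≫
    F.mapIso (((DerivedCategory.homologyFunctorFactors A i).app K).symm ≪≫
      (DerivedCategory.homologyFunctor A i).mapIso e)⟩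

end InducedFunctors

/-! ### Lattices in graded modules over the localization -/

namespace GrMod

variable {k B : Type u} [Field k] [Ring B] [Algebra k B] {𝓑 : ℤ → Submodule k B}

lemma isIso_of_bijective {M N : GrMod 𝓑} (f : M ⟶ N) (h : Function.Bijective (lin f)) :
    IsIso f := by
  have := (mono_iff f).2 h.1
  have := (epi_iff f).2 h.2
  exact isIso_of_mono_of_epi f

lemma proj_smul (M : GrMod 𝓑) {d : ℤ} {b : B} (hb : b ∈ 𝓑 d) (i : ℤ) (m : M) :
    M.proj (d + i) (b • m) = b • M.proj i m := by
  have hm := M.mem_iSup m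
  induction hm using Submodule.iSup_induction' with
  | mem j m hm =>
    rw [proj_of_mem M hm, proj_of_mem M (M.smul_mem hb hm)]
    by_cases h : j = i
    · rw [if_pos h, if_pos (by omega)]
    · rw [if_neg h, if_neg (by omega), smul_zero]
  | zero => simp
  | add x y _ _ hx hy => simp [smul_add, hx, hy]

/-- If the homogeneous components of the ring exhaust it, the elements all of whose homogeneous
components lie in a submodule are closed under multiplication by scalars. -/
lemma proj_smul_mem (h𝓑 : ⨆ i, 𝓑 i = ⊤) (M : GrMod 𝓑) (P : Submodule B M) {m : M}
    (hm : ∀ i, M.proj i m ∈ P) (b : B) (i : ℤ) : M.proj i (b • m) ∈ P := by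
  have hb : b ∈ ⨆ i, 𝓑 i := by rw [h𝓑]; trivial
  induction hb using Submodule.iSup_induction' with
  | mem d b hb =>
    have := M.proj_smul hb (i - d) m
    rw [add_sub_cancel] at this
    rw [this]
    exact P.smul_mem _ (hm _)
  | zero => simp
  | add x y _ _ hx hy => rw [add_smul, map_add]; exact P.add_mem hx hy

/-- A submodule spanned by homogeneous elements is homogeneous. -/
lemma proj_mem_span (h𝓑 : ⨆ i, 𝓑 i = ⊤) (M : GrMod 𝓑) {s : Set M}
    (hs : ∀ x ∈ s, ∃ i, x ∈ M.deg i) (i : ℤ) (m : M) (hm : m ∈ Submodule.span B s) :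
    M.proj i m ∈ Submodule.span B s := by
  revert i
  induction hm using Submodule.span_induction with
  | mem x hx =>
    intro i
    obtain ⟨j, hj⟩ := hs x hx
    rw [proj_of_mem M hj]
    split_ifs
    · exact Submodule.subset_span hx
    · exact zero_mem _
  | zero => intro i; simp
  | add x y _ _ hx hy => intro i; rw [map_add]; exact add_mem (hx i) (hy i)
  | smul b x _ hx => exact M.proj_smul_mem h𝓑 _ hx b

lemma exists_homogeneous_generators (M : GrMod 𝓑) (h : Module.Finite B M) :
    ∃ s : Finset M, (∀ x ∈ s, ∃ i, x ∈ M.deg i) ∧ Submodule.span B (s : Set M) = ⊤ := by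
  classical
  obtain ⟨s, hs⟩ := h
  choose t ht using M.exists_sum_proj
  refine ⟨s.biUnion fun m => (t m).image fun i => M.proj i m, ?_, ?_⟩
  · intro x hx
    simp only [Finset.mem_biUnion, Finset.mem_image] at hx
    obtain ⟨m, -, i, -, rfl⟩ := hx
    exact ⟨i, M.proj_mem i m⟩
  · rw [eq_top_iff, ← hs, Submodule.span_le]
    intro m hm
    rw [SetLike.mem_coe, ← ht m]
    refine Submodule.sum_mem _ fun i hi => Submodule.subset_span ?_
    simp only [Finset.coe_biUnion, Finset.coe_image, Set.mem_iUnion]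
    exact ⟨m, hm, i, hi, rfl⟩

/-- The inclusion of a graded submodule. -/
def subι (M : GrMod 𝓑) (P : Submodule B M) (hP : ∀ i, ∀ m ∈ P, M.proj i m ∈ P) :
    M.sub P hP ⟶ M :=
  ofLin (M := M.sub P hP) P.subtype fun _ _ h => h

lemma subι_injective (M : GrMod 𝓑) (P : Submodule B M) (hP) :
    Function.Injective (lin (M.subι P hP)) := P.injective_subtype

/-- The restriction of a morphism to graded submodules. -/
def subMap {M N : GrMod 𝓑} (f : M ⟶ N) {P : Submodule B M} (hP) {P' : Submodule B N} (hP')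
    (h : ∀ m ∈ P, lin f m ∈ P') : M.sub P hP ⟶ N.sub P' hP' :=
  ofLin (M := M.sub P hP) (N := N.sub P' hP')
    (((lin f).domRestrict P).codRestrict P' fun m => h m.1 m.2) fun _ _ hm => lin_deg f hm

end GrMod

namespace GAlgData

open OreLocalization

variable {k : Type u} [Field k] {n : ℕ} (D : GAlgData k n)

lemma iSup_grading : ⨆ i, D.grading i = ⊤ := D.grading_isInternal.submodule_iSup_eq_top

/-- A graded module over `(B_n)_Z`, viewed as a graded module over `B_n`. -/
noncomputable def res (N : GrMod D.gradingZ) : GrMod D.grading :=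
  letI : Module D.B N := Module.compHom N (numeratorRingHom (R := D.B) (S := D.S))
  { carrier := N
    addCommGroup := N.addCommGroup
    moduleBase := N.moduleBase
    module := inferInstance
    isScalarTower := ⟨fun c b m => by
      change (numeratorRingHom (R := D.B) (S := D.S) (c • b)) • m =
        c • (numeratorRingHom (R := D.B) (S := D.S) b) • m
      have : numeratorRingHom (R := D.B) (S := D.S) (c • b) =
          c • numeratorRingHom (R := D.B) (S := D.S) b :=
        (D.base_smul_oreDiv c b 1).symm
      rw [this, smul_assoc]⟩
    deg := N.deg
    isInternal := N.isInternal
    smul_mem := fun {i j b m} hb hm => by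
      refine N.smul_mem (i := i) (b := b /ₒ 1) ?_ hm
      exact ⟨0, b, by simpa using hb, by congr; exact Subtype.ext (pow_zero _).symm⟩ }

variable {D}

lemma zpw_zero : D.zpw 0 = 1 := Subtype.ext (pow_zero _)

/-- The identity map from a graded `(B_n)_Z`-module to its restriction to `B_n`. -/
noncomputable def toRes (N : GrMod D.gradingZ) : N ≃+ D.res N := AddEquiv.refl N

lemma toRes_symm_smul (N : GrMod D.gradingZ) (b : D.B) (x : D.res N) :
    (toRes N).symm (b • x) = (b /ₒ D.zpw 0 : D.BZ) • (toRes N).symm x := by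
  rw [zpw_zero]; rfl

lemma toRes_symm_mem (N : GrMod D.gradingZ) {i : ℤ} {x : D.res N} :
    (toRes N).symm x ∈ N.deg i ↔ x ∈ (D.res N).deg i := Iff.rfl

/-- A morphism of graded `(B_n)_Z`-modules, viewed as a morphism of graded `B_n`-modules. -/
noncomputable def resMap {N N' : GrMod D.gradingZ} (f : N ⟶ N') : D.res N ⟶ D.res N' :=
  GrMod.ofLin (M := D.res N) (N := D.res N')
    { toFun := fun x => toRes N' (GrMod.lin f ((toRes N).symm x))
      map_add' := fun x y => map_add (GrMod.lin f) x y
      map_smul' := fun b x => (GrMod.lin f).map_smul (b /ₒ 1 : D.BZ) x }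
    (fun _ _ h => GrMod.lin_deg f h)

lemma oreDiv_mul (a b : D.B) (i j : ℕ) :
    (a /ₒ D.zpw i : D.BZ) * (b /ₒ D.zpw j) = (a * b) /ₒ D.zpw (i + j) :=
  D.smul_zpw a b i j

lemma Zpow_oreDiv (i : ℕ) : (D.Z ^ i /ₒ D.zpw i : D.BZ) = 1 := by
  have := D.oreDiv_zpw (1 : D.B) i 0
  rw [add_zero, smul_eq_mul, mul_one] at this
  rw [← this, zpw_zero]; exact OreLocalization.one_def.symm

/-- Multiplication by `Z ^ i` undoes division by `Z ^ i`. -/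
lemma Zpow_smul_oreDiv (N : GrMod D.gradingZ) (i : ℕ) (x : N) :
    (D.Z ^ i /ₒ D.zpw 0 : D.BZ) • ((1 : D.B) /ₒ D.zpw i : D.BZ) • x = x := by
  rw [smul_smul, oreDiv_mul, zero_add, mul_one, Zpow_oreDiv, one_smul]

/-- The map `m / Z ^ i ↦ Z ^ (-i) f(m)` induced by a `B_n`-linear map into a module over
`(B_n)_Z`. -/
noncomputable def adjLin {M : GrMod D.grading} {N : GrMod D.gradingZ} (f : M ⟶ D.res N) :
    OreLocalization D.S M →ₗ[D.BZ] N where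
  toFun := liftExpand (fun m s => ((1 : D.B) /ₒ s : D.BZ) • (toRes N).symm (GrMod.lin f m))
    (fun m t s hs => by
      obtain ⟨l, rfl⟩ := D.exists_zpw s
      obtain ⟨j, hj⟩ := D.exists_zpw ⟨_, hs⟩
      rw [hj, map_smul, toRes_symm_smul, smul_smul, oreDiv_mul, one_mul, add_zero]
      congr 1
      have := OreLocalization.expand (1 : D.B) (D.zpw l) t hs
      rwa [hj, smul_eq_mul, mul_one] at this)
  map_add' x y := by
    obtain ⟨m, i, rfl⟩ := D.exists_rep x
    obtain ⟨m', j, rfl⟩ := D.exists_rep y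
    rw [add_zpw, liftExpand_of, liftExpand_of, liftExpand_of, map_add, map_smul, map_smul,
      map_add, smul_add, toRes_symm_smul, toRes_symm_smul, smul_smul, smul_smul, oreDiv_mul,
      oreDiv_mul, one_mul, one_mul, add_zero]
    have h1 := D.oreDiv_zpw (1 : D.B) j i
    have h2 := D.oreDiv_zpw (1 : D.B) i j
    rw [smul_eq_mul, mul_one] at h1 h2
    rw [h1, h2, add_comm j i]
  map_smul' r x := by
    obtain ⟨m, i, rfl⟩ := D.exists_rep x
    obtain ⟨b, j, rfl⟩ := D.exists_rep r
    rw [smul_zpw, liftExpand_of, liftExpand_of, RingHom.id_apply, map_smul, toRes_symm_smul,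
      smul_smul, smul_smul, oreDiv_mul, oreDiv_mul, one_mul, mul_one, add_zero]

/-- The morphism of graded `(B_n)_Z`-modules adjoint to a morphism into a restricted module. -/
noncomputable def adj {M : GrMod D.grading} {N : GrMod D.gradingZ} (f : M ⟶ D.res N) :
    D.locFunctor.obj M ⟶ N :=
  GrMod.ofLin (M := D.locObj M) (adjLin f) (by
    rintro i _ ⟨j, m, hm, rfl⟩
    change ((1 : D.B) /ₒ D.zpw j : D.BZ) • (toRes N).symm (GrMod.lin f m) ∈ N.deg i
    have h := N.smul_mem (i := -j) (b := (1 : D.B) /ₒ D.zpw j)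
      ⟨j, 1, by rw [neg_add_cancel]; exact D.one_mem, rfl⟩
      ((toRes_symm_mem N).2 (GrMod.lin_deg f hm))
    rwa [show -(j : ℤ) + (i + j) = i by ring] at h)

lemma lin_adj_oreDiv {M : GrMod D.grading} {N : GrMod D.gradingZ} (f : M ⟶ D.res N) (m : M)
    (i : ℕ) : GrMod.lin (adj f) (m /ₒ D.zpw i : OreLocalization D.S M) =
      ((1 : D.B) /ₒ D.zpw i : D.BZ) • (toRes N).symm (GrMod.lin f m) := rfl

lemma map_comp_adj {M M' : GrMod D.grading} {N : GrMod D.gradingZ} (g : M ⟶ M')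
    (f : M' ⟶ D.res N) : D.locFunctor.map g ≫ adj f = adj (g ≫ f) :=
  GrMod.hom_ext fun x => by
    obtain ⟨m, i, rfl⟩ := D.exists_rep (M := M) x
    rfl

lemma adj_comp {M : GrMod D.grading} {N N' : GrMod D.gradingZ} (f : M ⟶ D.res N) (g : N ⟶ N') :
    adj f ≫ g = adj (f ≫ resMap g) :=
  GrMod.hom_ext fun x => by
    obtain ⟨m, i, rfl⟩ := D.exists_rep (M := M) x
    exact (GrMod.lin g).map_smul ((1 : D.B) /ₒ D.zpw i : D.BZ) _

/-- A `B_n`-lattice in a graded `(B_n)_Z`-module, that is a graded `B_n`-submodule which generates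
it over `(B_n)_Z`, localizes to the whole module. -/
lemma isIso_adj {M : GrMod D.grading} {N : GrMod D.gradingZ} (f : M ⟶ D.res N)
    (hf : Function.Injective (GrMod.lin f))
    (hs : Submodule.span D.BZ (Set.range fun m => (toRes N).symm (GrMod.lin f m)) = ⊤) :
    IsIso (adj f) := by
  refine GrMod.isIso_of_bijective _ ⟨?_, ?_⟩
  · refine (injective_iff_map_eq_zero (GrMod.lin (adj f))).2 fun x hx => ?_
    obtain ⟨m, i, rfl⟩ := D.exists_rep (M := M) x
    rw [lin_adj_oreDiv] at hx
    have h := Zpow_smul_oreDiv N i ((toRes N).symm (GrMod.lin f m))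
    rw [hx, smul_zero, eq_comm, map_eq_zero_iff _ (toRes N).symm.injective,
      map_eq_zero_iff _ hf] at h
    rw [h]
    exact zero_oreDiv (D.zpw i)
  · rw [← LinearMap.range_eq_top, eq_top_iff, ← hs, Submodule.span_le]
    rintro _ ⟨m, rfl⟩
    refine ⟨(m /ₒ D.zpw 0 : OreLocalization D.S M), ?_⟩
    rw [lin_adj_oreDiv, zpw_zero, ← OreLocalization.one_def]
    exact one_smul D.BZ ((toRes N).symm (GrMod.lin f m))

end GAlgData

/-! ### Density of localization on complexes -/

namespace GAlgData

open OreLocalization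

variable {k : Type u} [Field k] {n : ℕ} {D : GAlgData k n}

section LatticeComplex

variable (K : CochainComplex D.grZ ℤ)

/-- A finite set of homogeneous generators of the `i`-th term of a complex. -/
noncomputable def cxGen (i : ℤ) : Finset (D.res (K.X i).obj) :=
  (GrMod.exists_homogeneous_generators (K.X i).obj (K.X i).property).choose.map
    (toRes (K.X i).obj).toEmbedding

lemma cxGen_homogeneous {i : ℤ} {x : D.res (K.X i).obj} (hx : x ∈ cxGen K i) :
    ∃ j, x ∈ (D.res (K.X i).obj).deg j := by
  obtain ⟨y, hy, rfl⟩ := Finset.mem_map.1 hx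
  exact (GrMod.exists_homogeneous_generators (K.X i).obj (K.X i).property).choose_spec.1 y hy

lemma span_cxGen (i : ℤ) :
    Submodule.span D.BZ ((toRes (K.X i).obj).symm '' (cxGen K i : Set (D.res (K.X i).obj))) = ⊤ := by
  rw [← (GrMod.exists_homogeneous_generators (K.X i).obj (K.X i).property).choose_spec.2]
  congr 1
  ext x
  simp [cxGen]

/-- The differentials of the complex of restricted modules. -/
noncomputable def resD (i j : ℤ) : D.res (K.X i).obj ⟶ D.res (K.X j).obj := resMap (K.d i j).hom

lemma resD_comp (i j l : ℤ) : resD K i j ≫ resD K j l = 0 :=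
  GrMod.hom_ext fun x =>
    GrMod.lin_apply_eq_zero (congrArg InducedCategory.Hom.hom (K.d_comp_d i j l)) x

lemma resD_eq_zero {i j : ℤ} (h : ¬ i + 1 = j) : resD K i j = 0 := by
  have h' : (K.d i j).hom = 0 := congrArg InducedCategory.Hom.hom (K.shape i j h)
  rw [resD, h']; rfl

/-- The generators of the `i`-th lattice: generators of the `i`-th term together with the images
of the chosen generators of the preceding one. -/
noncomputable def latGen (i : ℤ) : Set (D.res (K.X i).obj) :=
  cxGen K i ∪ GrMod.lin (resD K (i - 1) i) '' (cxGen K (i - 1))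

lemma latGen_homogeneous {i : ℤ} {x : D.res (K.X i).obj} (hx : x ∈ latGen K i) :
    ∃ j, x ∈ (D.res (K.X i).obj).deg j := by
  rcases hx with hx | ⟨y, hy, rfl⟩
  · exact cxGen_homogeneous K hx
  · obtain ⟨j, hj⟩ := cxGen_homogeneous K hy
    exact ⟨j, GrMod.lin_deg _ hj⟩

lemma latGen_finite (i : ℤ) : (latGen K i).Finite :=
  (Finset.finite_toSet _).union ((Finset.finite_toSet _).image _)

/-- The `i`-th lattice, the `B_n`-submodule spanned by `latGen K i`. -/
noncomputable def latSubmodule (i : ℤ) : Submodule D.B (D.res (K.X i).obj) :=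
  Submodule.span D.B (latGen K i)

lemma latSubmodule_proj_mem (i j : ℤ) (m : D.res (K.X i).obj) (hm : m ∈ latSubmodule K i) :
    (D.res (K.X i).obj).proj j m ∈ latSubmodule K i :=
  GrMod.proj_mem_span D.iSup_grading _ (fun _ => latGen_homogeneous K) j m hm

/-- The lattices form a subcomplex: the second half of the generators makes room for the images of
the first half of the preceding ones, and is itself killed by the differential. -/
lemma resD_mem_latSubmodule (i j : ℤ) (m : D.res (K.X i).obj) (hm : m ∈ latSubmodule K i) :
    GrMod.lin (resD K i j) m ∈ latSubmodule K j := by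
  by_cases hij : i + 1 = j
  · obtain rfl : i = j - 1 := by omega
    induction hm using Submodule.span_induction with
    | mem x hx =>
      rcases hx with hx | ⟨y, hy, rfl⟩
      · exact Submodule.subset_span (Or.inr ⟨x, hx, rfl⟩)
      · rw [GrMod.lin_apply_eq_zero (resD_comp K _ _ _)]; exact zero_mem _
    | zero => rw [map_zero]; exact zero_mem _
    | add x y _ _ hx hy => rw [map_add]; exact add_mem hx hy
    | smul b x _ hx => rw [map_smul]; exact Submodule.smul_mem _ _ hx
  · rw [resD_eq_zero K hij]; exact zero_mem _

/-- The complex of lattices. -/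
noncomputable def latComplex : CochainComplex D.gr ℤ where
  X i := ⟨(D.res (K.X i).obj).sub (latSubmodule K i) (latSubmodule_proj_mem K i),
    Module.Finite.span_of_finite _ (latGen_finite K i)⟩
  d i j := InducedCategory.homMk (GrMod.subMap (resD K i j)
    (latSubmodule_proj_mem K i) (latSubmodule_proj_mem K j) (resD_mem_latSubmodule K i j))
  shape i j h := by
    apply InducedCategory.Hom.ext
    refine GrMod.hom_ext fun m => Subtype.ext ?_
    exact LinearMap.congr_fun (congrArg GrMod.lin (resD_eq_zero K h)) m.1
  d_comp_d' i j l _ _ := by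
    apply InducedCategory.Hom.ext
    exact GrMod.hom_ext fun m => Subtype.ext (GrMod.lin_apply_eq_zero (resD_comp K i j l) m.1)

/-- The inclusion of a lattice. -/
noncomputable def latι (i : ℤ) : ((latComplex K).X i).obj ⟶ D.res (K.X i).obj :=
  GrMod.subι _ (latSubmodule K i) (latSubmodule_proj_mem K i)

lemma latι_injective (i : ℤ) : Function.Injective (GrMod.lin (latι K i)) :=
  GrMod.subι_injective _ (latSubmodule K i) (latSubmodule_proj_mem K i)

lemma isIso_adj_latι (i : ℤ) : IsIso (adj (latι K i)) := by
  refine isIso_adj _ (latι_injective K i) (eq_top_iff.2 ?_)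
  rw [← span_cxGen K i]
  refine Submodule.span_mono ?_
  rintro _ ⟨x, hx, rfl⟩
  exact ⟨⟨x, Submodule.subset_span (Or.inl hx)⟩, rfl⟩

/-- The localization of the complex of lattices is the given complex. -/
noncomputable def latIso : (D.Q.mapHomologicalComplex (ComplexShape.up ℤ)).obj (latComplex K) ≅ K :=
  HomologicalComplex.Hom.isoOfComponents
    (fun i =>
      have := isIso_adj_latι K i
      let e : D.locFunctor.obj ((latComplex K).X i).obj ≅ (K.X i).obj := asIso (adj (latι K i))
      ObjectProperty.isoMk _ e)
    (fun i j _ => by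
      apply InducedCategory.Hom.ext
      exact (adj_comp (latι K i) (K.d i j).hom).trans
        (map_comp_adj ((latComplex K).d i j).hom (latι K j)).symm)

lemma latComplex_isZero {i : ℤ} (h : IsZero (K.X i)) : IsZero ((latComplex K).X i) := by
  rw [IsZero.iff_id_eq_zero] at h ⊢
  apply InducedCategory.Hom.ext
  have h' : GrMod.lin (𝟙 (K.X i).obj) = 0 :=
    congrArg (fun f : K.X i ⟶ K.X i => GrMod.lin f.hom) h
  exact GrMod.hom_ext fun m => Subtype.ext (LinearMap.congr_fun h' m.1)

end LatticeComplex

lemma essSurj_mapCb_Q : (mapCb D.Q).EssSurj where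
  mem_essImage X := by
    obtain ⟨K, ⟨a, ha⟩, b, hb⟩ := X
    refine ⟨⟨latComplex K, ⟨a, ?_⟩, b, ?_⟩, ⟨ObjectProperty.isoMk _ (latIso K)⟩⟩
    · rw [CochainComplex.isStrictlyGE_iff]
      exact fun i hi => latComplex_isZero K (K.isZero_of_isStrictlyGE a i hi)
    · rw [CochainComplex.isStrictlyLE_iff]
      exact fun i hi => latComplex_isZero K (K.isZero_of_isStrictlyLE b i hi)

lemma isZero_Q_obj_iff (M : D.gr) : IsZero (D.Q.obj M) ↔ D.IsZTorsion M := by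
  rw [IsZero.iff_id_eq_zero]
  constructor
  · intro h m
    obtain ⟨l, hl⟩ := (D.oreDiv_eq_zero m (D.zpw 0)).1
      (LinearMap.congr_fun (congrArg (fun f => GrMod.lin f.hom) h) (m /ₒ D.zpw 0))
    -- `Z`-torsion asks for a positive exponent, while `l` may be zero
    exact ⟨l + 1, Nat.succ_pos _, by rw [pow_succ', mul_smul, hl, smul_zero]⟩
  · intro h
    apply InducedCategory.Hom.ext
    refine GrMod.hom_ext fun x => ?_
    obtain ⟨m, i, rfl⟩ := D.exists_rep (M := M.obj) x
    obtain ⟨l, -, hl⟩ := h m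
    exact (D.oreDiv_eq_zero m _).2 ⟨l, hl⟩

end GAlgData

/-! ### Truncations of graded modules and morphisms of `Qgr` -/

namespace GAlgData

variable {k : Type u} [Field k] {n : ℕ} {D : GAlgData k n}

lemma grading_eq_bot {d : ℤ} (hd : d < 0) : D.grading d = ⊥ := by
  rw [grading, Submodule.span_eq_bot]
  rintro _ ⟨l, hl, rfl⟩
  omega

/-- The submodule `M_{≥ p}` of the elements without components in degrees less than `p`. It is
stable under `B_n` because `B_n` vanishes in negative degrees. -/
noncomputable def truncSubmodule (p : ℤ) (M : GrMod D.grading) : Submodule D.B M where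
  carrier := {m | ∀ i < p, M.proj i m = 0}
  zero_mem' i _ := map_zero _
  add_mem' hx hy i hi := by rw [map_add, hx i hi, hy i hi, add_zero]
  smul_mem' b m hm i hi := by
    have hb : b ∈ ⨆ i, D.grading i := by rw [D.iSup_grading]; trivial
    induction hb using Submodule.iSup_induction' with
    | mem d b hb =>
      by_cases hd : d < 0
      · rw [grading_eq_bot hd, Submodule.mem_bot] at hb
        rw [hb, zero_smul, map_zero]
      · have := M.proj_smul hb (i - d) m
        rw [add_sub_cancel, hm (i - d) (by omega), smul_zero] at this
        exact this
    | zero => rw [zero_smul, map_zero]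
    | add x y _ _ hx hy => rw [add_smul, map_add, hx, hy, add_zero]

lemma mem_truncSubmodule_of_mem_deg {p i : ℤ} (hi : p ≤ i) {M : GrMod D.grading} {m : M}
    (hm : m ∈ M.deg i) : m ∈ truncSubmodule p M := fun j hj => by
  rw [M.proj_of_mem hm, if_neg (by omega)]

lemma truncSubmodule_proj_mem (p : ℤ) (M : GrMod D.grading) (i : ℤ) (m : M)
    (hm : m ∈ truncSubmodule p M) : M.proj i m ∈ truncSubmodule p M := by
  by_cases hi : i < p
  · rw [hm i hi]; exact zero_mem _
  · exact mem_truncSubmodule_of_mem_deg (not_lt.1 hi) (M.proj_mem i m)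

/-- The graded submodule `M_{≥ p}` of a finitely generated graded module `M`. -/
noncomputable def truncObj (p : ℤ) (M : D.gr) : D.gr :=
  ⟨M.obj.sub (truncSubmodule p M.obj) (truncSubmodule_proj_mem p M.obj), by
    have := (GrMod.mono_iff _).2 (GrMod.subι_injective M.obj _ (truncSubmodule_proj_mem p M.obj))
    exact (GrMod.fg D.grading).prop_of_mono (M.obj.subι _ (truncSubmodule_proj_mem p M.obj))
      M.property⟩

/-- The inclusion of `M_{≥ p}` in `M`. -/
noncomputable def truncι (p : ℤ) (M : D.gr) : truncObj p M ⟶ M :=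
  InducedCategory.homMk (M.obj.subι _ (truncSubmodule_proj_mem p M.obj))

instance (p : ℤ) (M : D.gr) : Mono (truncι p M) :=
  (GrMod.gr_mono_iff _).2 (GrMod.subι_injective M.obj _ (truncSubmodule_proj_mem p M.obj))

lemma lin_truncι_mem (p : ℤ) (M : D.gr) (m : (truncObj p M).obj) :
    GrMod.lin (truncι p M).hom m ∈ truncSubmodule p M.obj := m.2

lemma proj_truncObj (p : ℤ) (M : D.gr) (m : (truncObj p M).obj) {i : ℤ} (hi : i < p) :
    (truncObj p M).obj.proj i m = 0 := by
  apply (GrMod.gr_mono_iff (truncι p M)).1 inferInstance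
  rw [GrMod.lin_proj, map_zero]
  exact lin_truncι_mem p M m i hi

/-- A morphism from a truncation factors through the truncation of its target. -/
lemma exists_comp_truncι {p : ℤ} {M N : D.gr} (f : truncObj p M ⟶ N) :
    ∃ f' : truncObj p M ⟶ truncObj p N, f' ≫ truncι p N = f := by
  refine ⟨InducedCategory.homMk (GrMod.ofLin (N := (truncObj p N).obj)
    ((GrMod.lin f.hom).codRestrict (truncSubmodule p N.obj) fun m i hi => ?_)
      fun i m hm => GrMod.lin_deg f.hom hm), rfl⟩
  rw [← GrMod.lin_proj, proj_truncObj p M m hi, map_zero]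

/-- The restriction of a morphism to truncations. -/
noncomputable def truncMap (p : ℤ) {M N : D.gr} (f : M ⟶ N) : truncObj p M ⟶ truncObj p N :=
  (exists_comp_truncι (truncι p M ≫ f)).choose

lemma truncMap_truncι (p : ℤ) {M N : D.gr} (f : M ⟶ N) :
    truncMap p f ≫ truncι p N = truncι p M ≫ f :=
  (exists_comp_truncι (truncι p M ≫ f)).choose_spec

lemma truncMap_comp (p : ℤ) {M N P : D.gr} (f : M ⟶ N) (g : N ⟶ P) :
    truncMap p (f ≫ g) = truncMap p f ≫ truncMap p g := by
  rw [← cancel_mono (truncι p P), Category.assoc, truncMap_truncι, truncMap_truncι,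
    ← Category.assoc, ← Category.assoc, truncMap_truncι]

/-- Finite generation forces `M / M_{≥ p}` to be finite dimensional: it is spanned by the products
of homogeneous generators with short words. -/
lemma isoModSerre_truncι (p : ℤ) (M : D.gr) :
    (GrMod.torsion D.grading).isoModSerre (truncι p M) := by
  classical
  rw [ObjectProperty.isoModSerre_iff_of_mono]
  refine (GrMod.torsion_iff _).2 ?_
  set q := GrMod.lin (cokernel.π (truncι p M)).hom
  have hq : ∀ m ∈ truncSubmodule p M.obj, q m = 0 := fun m hm =>
    GrMod.lin_apply_eq_zero (congrArg InducedCategory.Hom.hom (cokernel.condition (truncι p M)))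
      (⟨m, hm⟩ : truncSubmodule p M.obj)
  have hqs : Function.Surjective q := (GrMod.gr_epi_iff (cokernel.π (truncι p M))).1 inferInstance
  obtain ⟨s, hs, hspan⟩ := GrMod.exists_homogeneous_generators M.obj M.property
  choose! j hj using hs
  -- words longer than `N` send every chosen generator into `M_{≥ p}`
  let N : ℕ := s.sup fun x => (p - j x).toNat
  let W : Submodule k (cokernel (truncι p M)).obj := Submodule.span k
    ((fun z : List (Option (Fin n)) × M.obj => q ((z.1.map D.gen).prod • z.2)) ''
      ({l | l.length ≤ N} ×ˢ (s : Set M.obj)))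
  have hW : ∀ m : M.obj, ∀ b : D.B, q (b • m) ∈ W := by
    intro m
    have hm : m ∈ Submodule.span D.B (s : Set M.obj) := by rw [hspan]; trivial
    induction hm using Submodule.span_induction with
    | mem x hx =>
      intro b
      have hb : b ∈ Submodule.span k {x | ∃ l : List (Option (Fin n)), x = (l.map D.gen).prod} := by
        rw [D.span_words]; trivial
      induction hb using Submodule.span_induction with
      | mem b hb =>
        obtain ⟨l, rfl⟩ := hb
        by_cases hl : l.length ≤ N
        · exact Submodule.subset_span ⟨(l, x), ⟨hl, hx⟩, rfl⟩
        · have hle : (p - j x).toNat ≤ N := Finset.le_sup (f := fun x => (p - j x).toNat) hx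
          rw [hq _ (mem_truncSubmodule_of_mem_deg (i := l.length + j x) (by omega)
            (M.obj.smul_mem (Submodule.subset_span ⟨l, rfl, rfl⟩) (hj x hx)))]
          exact zero_mem _
      | zero => rw [zero_smul, map_zero]; exact zero_mem _
      | add b c _ _ hb hc => rw [add_smul, map_add]; exact add_mem hb hc
      | smul c b _ hb =>
        rw [smul_assoc, GrMod.lin_smul]; exact Submodule.smul_mem _ _ hb
    | zero => intro b; rw [smul_zero, map_zero]; exact zero_mem _
    | add x y _ _ hx hy => intro b; rw [smul_add, map_add]; exact add_mem (hx b) (hy b)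
    | smul c x _ hx => intro b; rw [smul_smul]; exact hx _
  have hWfin : W.FG := Submodule.fg_span
    (((List.finite_length_le _ N).prod (Finset.finite_toSet s)).image _)
  have hWtop : W = ⊤ := by
    rw [eq_top_iff]
    intro y _
    obtain ⟨m, rfl⟩ := hqs y
    simpa using hW m 1
  exact ⟨hWtop ▸ hWfin⟩

instance (p : ℤ) (M : D.gr) : IsIso (D.π.map (truncι p M)) :=
  Localization.inverts D.π _ _ (isoModSerre_truncι p M)

/-- Torsion modules are bounded above, being finite dimensional. -/
lemma exists_deg_eq_bot_of_torsion (M : D.gr) (h : GrMod.torsion D.grading M) :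
    ∃ p : ℤ, ∀ i, p ≤ i → M.obj.deg i = ⊥ := by
  rw [GrMod.torsion_iff] at h
  have hind := (DirectSum.isInternal_submodule_iff_iSupIndep_and_iSup_eq_top _).1 M.obj.isInternal
  have hfin : {i | M.obj.deg i ≠ ⊥}.Finite := WellFoundedGT.finite_ne_bot_of_iSupIndep hind.1
  obtain ⟨K, hK⟩ := hfin.bddAbove
  refine ⟨K + 1, fun i hi => ?_⟩
  by_contra hne
  exact absurd (hK hne) (by omega)

/-- A morphism with torsion kernel and cokernel has a section over all sufficiently high
truncations of its target, since it is bijective in high degrees. -/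
lemma exists_section_of_isoModSerre {M' M : D.gr} (s : M' ⟶ M)
    (hs : (GrMod.torsion D.grading).isoModSerre s) :
    ∃ p : ℤ, ∀ q, p ≤ q → ∃ t : truncObj q M ⟶ M', t ≫ s = truncι q M := by
  obtain ⟨p₁, h₁⟩ := exists_deg_eq_bot_of_torsion (kernel s) hs.1
  obtain ⟨p₂, h₂⟩ := exists_deg_eq_bot_of_torsion (cokernel s) hs.2
  refine ⟨max p₁ p₂, fun q hq => ?_⟩
  have inj : ∀ i, q ≤ i → ∀ m ∈ M'.obj.deg i, GrMod.lin s.hom m = 0 → m = 0 := by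
    intro i hi m hm hsm
    have hex : (ShortComplex.mk _ _ (kernel.condition s)).Exact :=
      ShortComplex.exact_of_f_is_kernel _ (kernelIsKernel s)
    obtain ⟨x, hx⟩ := (GrMod.gr_exact_iff _).1 hex m hsm
    change GrMod.lin (kernel.ι s).hom x = m at hx
    have hxi : x ∈ (kernel s).obj.deg i := GrMod.mem_deg_of_injective _
      ((GrMod.gr_mono_iff (kernel.ι s)).1 inferInstance) (by rwa [hx])
    rw [h₁ i (by omega), Submodule.mem_bot] at hxi
    rw [← hx, hxi, map_zero]
  have surj : ∀ i, q ≤ i → ∀ m ∈ M.obj.deg i, ∃ m' ∈ M'.obj.deg i, GrMod.lin s.hom m' = m := by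
    intro i hi m hm
    have hex : (ShortComplex.mk _ _ (cokernel.condition s)).Exact :=
      ShortComplex.exact_of_g_is_cokernel _ (cokernelIsCokernel s)
    have hm' := GrMod.lin_deg (cokernel.π s).hom hm
    rw [h₂ i (by omega), Submodule.mem_bot] at hm'
    obtain ⟨x, hx⟩ := (GrMod.gr_exact_iff _).1 hex m hm'
    change GrMod.lin s.hom x = m at hx
    exact ⟨M'.obj.proj i x, M'.obj.proj_mem i x, by
      rw [GrMod.lin_proj, hx, M.obj.proj_of_mem hm, if_pos rfl]⟩
  -- `inj` and `surj` say that `s` is bijective in degrees at least `q`, so that it restricts to an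
  -- isomorphism on truncations
  have hmono : Mono (truncMap q s) := by
    have : Mono (truncι q M' ≫ s) := by
      rw [GrMod.gr_mono_iff]
      refine (injective_iff_map_eq_zero (GrMod.lin (truncι q M' ≫ s).hom)).2 fun m hm => ?_
      refine (GrMod.gr_mono_iff (truncι q M')).1 inferInstance ?_
      rw [map_zero]
      refine GrMod.ext_proj _ fun i => ?_
      rw [map_zero]
      by_cases hi : i < q
      · exact lin_truncι_mem q M' m i hi
      · refine inj i (not_lt.1 hi) _ (GrMod.proj_mem _ _ _) ?_
        rw [GrMod.lin_proj]
        exact (congrArg (M.obj.proj i) hm).trans (map_zero _)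
    rw [← truncMap_truncι] at this
    exact mono_of_mono _ (truncι q M)
  have hepi : Epi (truncMap q s) := by
    rw [GrMod.gr_epi_iff]
    intro m
    obtain ⟨S, hS⟩ := M.obj.exists_sum_proj (GrMod.lin (truncι q M).hom m)
    have key : ∀ i, ∃ x ∈ truncSubmodule q M'.obj,
        GrMod.lin s.hom x = M.obj.proj i (GrMod.lin (truncι q M).hom m) := by
      intro i
      by_cases hi : i < q
      · exact ⟨0, zero_mem _, by rw [map_zero, lin_truncι_mem q M m i hi]⟩
      · obtain ⟨x, hx, hx'⟩ := surj i (not_lt.1 hi) _ (M.obj.proj_mem i _)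
        exact ⟨x, mem_truncSubmodule_of_mem_deg (not_lt.1 hi) hx, hx'⟩
    choose x hx hxm using key
    refine ⟨⟨∑ i ∈ S, x i, Submodule.sum_mem _ fun i _ => hx i⟩, ?_⟩
    refine (GrMod.gr_mono_iff (truncι q M)).1 inferInstance ?_
    rw [← hS]
    refine (LinearMap.congr_fun (congrArg (fun f => GrMod.lin f.hom)
      (truncMap_truncι q s)) _).trans ?_
    change GrMod.lin s.hom (∑ i ∈ S, x i) = _
    rw [map_sum]
    exact Finset.sum_congr rfl fun i _ => hxm i
  have : IsIso (truncMap q s) := isIso_of_mono_of_epi _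
  exact ⟨inv (truncMap q s) ≫ truncι q M', by
    rw [Category.assoc, ← truncMap_truncι, IsIso.inv_hom_id_assoc]⟩

/-- A morphism of `Qgr` is represented by a morphism from every sufficiently high truncation. -/
lemma exists_map_eq_truncι_comp {M N : D.gr} (g : D.π.obj M ⟶ D.π.obj N) :
    ∃ p : ℤ, ∀ q, p ≤ q → ∃ f : truncObj q M ⟶ N, D.π.map f = D.π.map (truncι q M) ≫ g := by
  obtain ⟨φ, rfl⟩ := Localization.exists_rightFraction D.π
    (GrMod.torsion D.grading).isoModSerre g
  obtain ⟨p, hp⟩ := exists_section_of_isoModSerre φ.s φ.hs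
  refine ⟨p, fun q hq => ?_⟩
  obtain ⟨t, ht⟩ := hp q hq
  refine ⟨t ≫ φ.f, ?_⟩
  rw [← ht, D.π.map_comp, D.π.map_comp, Category.assoc,
    MorphismProperty.RightFraction.map_s_comp_map]

lemma exists_truncMap_eq_zero {M N : D.gr} (f : M ⟶ N) (hf : D.π.map f = 0) :
    ∃ p : ℤ, ∀ q, p ≤ q → truncMap q f = 0 := by
  rw [← D.π.map_zero, MorphismProperty.map_eq_iff_precomp D.π
    (GrMod.torsion D.grading).isoModSerre] at hf
  obtain ⟨X, s, hs, h⟩ := hf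
  obtain ⟨p, hp⟩ := exists_section_of_isoModSerre s hs
  refine ⟨p, fun q hq => ?_⟩
  obtain ⟨t, ht⟩ := hp q hq
  rw [← cancel_mono (truncι q N), truncMap_truncι, ← ht, Category.assoc, h, comp_zero, comp_zero,
    zero_comp]

end GAlgData

/-! ### Complexes in `Qgr` and the kernel of `D^b(ψ)` -/

namespace GAlgData

variable {k : Type u} [Field k] {n : ℕ} {D : GAlgData k n}

lemma isZero_truncObj (p : ℤ) {M : D.gr} (h : IsZero M) : IsZero (truncObj p M) :=
  IsZero.of_mono (truncι p M) h

/-- Every object of `Qgr` comes from `gr`; choosing zero for zero objects preserves boundedness when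
this is applied to the terms of a complex. -/
lemma exists_π_obj_iso (X : D.qgr) :
    ∃ M : D.gr, Nonempty (D.π.obj M ≅ X) ∧ (IsZero X → IsZero M) := by
  by_cases h : IsZero X
  · exact ⟨0, ⟨(D.π.map_isZero (isZero_zero _)).iso h⟩, fun _ => isZero_zero _⟩
  · have := Localization.essSurj D.π (GrMod.torsion D.grading).isoModSerre
    exact ⟨D.π.objPreimage X, ⟨D.π.objObjPreimageIso X⟩, fun h' => absurd h' h⟩

lemma exists_forall_le_of_mem_Icc (p : ℤ → ℤ) (a b : ℤ) :
    ∃ q, ∀ i, a ≤ i → i ≤ b → p i ≤ q := by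
  obtain ⟨q, hq⟩ := ((Finset.Icc a b).image p).exists_le
  exact ⟨q, fun i ha hb => hq _ (Finset.mem_image_of_mem p (Finset.mem_Icc.2 ⟨ha, hb⟩))⟩

/-- Bounded complexes in `Qgr` lift to `gr`: a first truncation makes all the differentials come
from `gr`, and a second one makes their composites vanish. Boundedness lets one degree serve for
all terms. -/
lemma essSurj_mapCb_π : (mapCb D.π).EssSurj where
  mem_essImage X := by
    obtain ⟨K, ⟨a, ha⟩, b, hb⟩ := X
    have hK : ∀ i, ¬ (a ≤ i ∧ i ≤ b) → IsZero (K.X i) := fun i hi => by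
      by_cases h : i < a
      · exact K.isZero_of_isStrictlyGE a i h
      · exact K.isZero_of_isStrictlyLE b i (by omega)
    choose M he hM using fun i => exists_π_obj_iso (K.X i)
    let e i := (he i).some
    let g i : D.π.obj (M i) ⟶ D.π.obj (M (i + 1)) :=
      (e i).hom ≫ K.d i (i + 1) ≫ (e (i + 1)).inv
    choose p hp using fun i => exists_map_eq_truncι_comp (g i)
    obtain ⟨P, hP⟩ := exists_forall_le_of_mem_Icc p a b
    have hf : ∀ i, ∃ f : truncObj P (M i) ⟶ truncObj P (M (i + 1)),
        D.π.map f ≫ D.π.map (truncι P _) = D.π.map (truncι P _) ≫ g i := by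
      intro i
      by_cases hi : a ≤ i ∧ i ≤ b
      · obtain ⟨f, hf⟩ := hp i P (hP i hi.1 hi.2)
        obtain ⟨f', hf'⟩ := exists_comp_truncι f
        exact ⟨f', by rw [← D.π.map_comp, hf', hf]⟩
      · have hg : g i = 0 := (D.π.map_isZero (hM i (hK i hi))).eq_of_src _ _
        exact ⟨0, by rw [hg, D.π.map_zero, zero_comp, comp_zero]⟩
    choose f hf using hf
    have hff : ∀ i, D.π.map (f i ≫ f (i + 1)) = 0 := by
      intro i
      rw [← cancel_mono (D.π.map (truncι P _)), D.π.map_comp, Category.assoc, hf, zero_comp,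
        reassoc_of% (hf i)]
      simp [g]
    choose p' hp' using fun i => exists_truncMap_eq_zero _ (hff i)
    obtain ⟨P', hP'⟩ := exists_forall_le_of_mem_Icc p' a b
    have hd : ∀ i, truncMap P' (f i) ≫ truncMap P' (f (i + 1)) = 0 := by
      intro i
      by_cases hi : a ≤ i ∧ i ≤ b
      · rw [← truncMap_comp, hp' i P' (hP' i hi.1 hi.2)]
      · exact (isZero_truncObj P' (isZero_truncObj P (hM i (hK i hi)))).eq_of_src _ _
    let L : CochainComplex D.gr ℤ := CochainComplex.of _ _ hd
    have hL : ∀ i, IsZero (K.X i) → IsZero (L.X i) := fun i hi =>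
      isZero_truncObj P' (isZero_truncObj P (hM i hi))
    let E : ∀ i, D.π.obj (truncObj P' (truncObj P (M i))) ≅ K.X i := fun i =>
      asIso (D.π.map (truncι P' (truncObj P (M i)))) ≪≫ asIso (D.π.map (truncι P (M i))) ≪≫ e i
    refine ⟨⟨L, ⟨a, ?_⟩, b, ?_⟩, ⟨ObjectProperty.isoMk _
      (HomologicalComplex.Hom.isoOfComponents E ?_)⟩⟩
    · rw [CochainComplex.isStrictlyGE_iff]
      exact fun i hi => hL i (K.isZero_of_isStrictlyGE a i hi)
    · rw [CochainComplex.isStrictlyLE_iff]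
      exact fun i hi => hL i (K.isZero_of_isStrictlyLE b i hi)
    · rintro i _ rfl
      have hLd : L.d i (i + 1) = truncMap P' (f i) := CochainComplex.of_d _ (fun i => truncMap P' (f i)) i
      change (D.π.map _ ≫ D.π.map _ ≫ (e i).hom) ≫ K.d i (i + 1) =
        D.π.map (L.d i (i + 1)) ≫ D.π.map _ ≫ D.π.map _ ≫ (e (i + 1)).hom
      have hT : D.π.map (truncMap P' (f i)) ≫ D.π.map (truncι P' _) =
          D.π.map (truncι P' _) ≫ D.π.map (f i) := by
        rw [← D.π.map_comp, truncMap_truncι, D.π.map_comp]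
      rw [hLd, reassoc_of% hT, reassoc_of% (hf i)]
      simp [g]

lemma essSurj_mapCb_ψ : (mapCb D.ψ).EssSurj where
  mem_essImage X := by
    obtain ⟨M, ⟨e⟩⟩ := (mapCb_congr_essSurj D.πCompψ.symm essSurj_mapCb_Q).mem_essImage X
    exact ⟨(mapCb D.π).obj M, ⟨ObjectProperty.isoMk _ ((boundedComplex D.grZ).ι.mapIso e)⟩⟩

/-- The homology of `D^b(ψ) D^b(π) M` is the localization of the homology of `M`. -/
lemma kerDb_ψ_π_iff [HasDerivedCategory.{w₁} D.gr] [HasDerivedCategory.{w₂} D.qgr]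
    [HasDerivedCategory.{w₃} D.grZ] (M : DerivedCategory.Bounded D.gr) :
    kerDb D.ψ ((mapDb D.π).obj M) ↔
      ∀ i : ℤ, D.IsZTorsion ((DerivedCategory.homologyFunctor D.gr i).obj M.obj) := by
  refine forall_congr' fun i => ?_
  rw [← isZero_Q_obj_iff]
  obtain ⟨e₁⟩ := nonempty_homologyFunctor_mapDerivedCategory_iso D.ψ ((mapDb D.π).obj M).obj i
  obtain ⟨e₂⟩ := nonempty_homologyFunctor_mapDerivedCategory_iso D.π M.obj i
  exact (e₁ ≪≫ D.ψ.mapIso e₂ ≪≫ D.πCompψ.app _).isZero_iff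

end GAlgData

lemma kerDb_iff_of_iso {A A' : Type*} [Category* A] [Abelian A] [Category* A'] [Abelian A']
    [HasDerivedCategory.{w₁} A] [HasDerivedCategory.{w₂} A'] (F : A ⥤ A') [F.Additive]
    [PreservesFiniteLimits F] [PreservesFiniteColimits F] {X Y : DerivedCategory.Bounded A}
    (e : X ≅ Y) : kerDb F X ↔ kerDb F Y :=
  forall_congr' fun i => ((DerivedCategory.homologyFunctor A' i).mapIso
    (DerivedCategory.Bounded.ι.mapIso ((mapDb F).mapIso e))).isZero_iff

theorem mainTheorem4 {k : Type u} [Field k] [CharZero k] (n : ℕ) (D : GAlgData k n)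
    [HasDerivedCategory.{w₁} D.gr] [HasDerivedCategory.{w₂} D.qgr]
    [HasDerivedCategory.{w₃} D.grZ] :
    (mapCb D.Q).EssSurj ∧ (mapCb D.ψ).EssSurj ∧
    (mapKb D.Q).EssSurj ∧ (mapKb D.ψ).EssSurj ∧
    (mapDb D.Q).EssSurj ∧ (mapDb D.ψ).EssSurj ∧
    ∀ X : DerivedCategory.Bounded D.qgr,
      kerDb D.ψ X ↔
        ∃ M : DerivedCategory.Bounded D.gr,
          (∀ i : ℤ, D.IsZTorsion ((DerivedCategory.homologyFunctor D.gr i).obj M.obj)) ∧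
          Nonempty (X ≅ (mapDb D.π).obj M) := by
  refine ⟨GAlgData.essSurj_mapCb_Q, GAlgData.essSurj_mapCb_ψ,
    essSurj_mapKb _ GAlgData.essSurj_mapCb_Q, essSurj_mapKb _ GAlgData.essSurj_mapCb_ψ,
    essSurj_mapDb _ GAlgData.essSurj_mapCb_Q, essSurj_mapDb _ GAlgData.essSurj_mapCb_ψ,
    fun X => ⟨fun hX => ?_, ?_⟩⟩
  · obtain ⟨M, ⟨e⟩⟩ := (essSurj_mapDb D.π GAlgData.essSurj_mapCb_π).mem_essImage X
    exact ⟨M, (GAlgData.kerDb_ψ_π_iff M).1 ((kerDb_iff_of_iso D.ψ e).2 hX), ⟨e.symm⟩⟩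
  · rintro ⟨M, hM, ⟨e⟩⟩
    exact (kerDb_iff_of_iso D.ψ e).2 ((GAlgData.kerDb_ψ_π_iff M).2 hM)
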